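/- Let $p\in\mathbb{C}$, $p\neq 0$. Let $\mathcal{S}(p)$ be the Lie conformal superalgebra which is the free $\mathbb{C}[\partial]$-module with even basis elements $L_i,W_i$ and odd basis elements $G_i$ $(i\in\mathbb{Z}_{\ge 0})$ and with $\lambda$-brackets $$[L_i\,{}_\lambda\,L_j]=\big((i+p)\partial+(i+j+2p)\lambda\big)L_{i+j},\qquad [L_i\,{}_\lambda\,W_j]=\big((i+p)\partial+(i+j+p)\lambda\big)W_{i+j},$$ $$[L_i\,{}_\lambda\,G_j]=\big((i+p)\partial+(i+j+2p)\lambda\big)G_{i+j},\qquad [W_i\,{}_\lambda\,G_j]=G_{i+j},\qquad [W_i\,{}_\lambda\,W_j]=[G_i\,{}_\lambda\,G_j]=0 .$$ Define the following conformal $\mathcal{S}(p)$-modules $\mathbb{C}[\partial]v_{\bar 0}\oplus\mathbb{C}[\partial]v_{\bar 1}$, with $v_{\bar 0}$ even and $v_{\bar 1}$ odd. All $\lambda$-actions of generators $L_i,W_i,G_i$ on $v_{\bar 0},v_{\bar 1}$ that are not listed are zero. Parameters are complex numbers, $\sigma\ne0$, and $c=c'=0$ unless $p=-1$. * $V_{a,b,c,d,a',b',c',d'}$: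 $\;L_0\,{}_\lambda\,v_{\bar 0}=p(\partial+a\lambda+b)v_{\bar 0}$, $L_1\,{}_\lambda\,v_{\bar 0}=c\,v_{\bar 0}$, $W_0\,{}_\lambda\,v_{\bar 0}=d\,v_{\bar 0}$; $\;L_0\,{}_\lambda\,v_{\bar 1}=p(\partial+a'\lambda+b')v_{\bar 1}$, $L_1\,{}_\lambda\,v_{\bar 1}=c'v_{\bar 1}$, $W_0\,{}_\lambda\,v_{\bar 1}=d'v_{\bar 1}$. * $V_{a,b,c,d,\sigma}$: $\;L_0\,{}_\lambda\,v_{\bar 0}=p(\partial+a\lambda+b)v_{\bar 0}$, $L_1\,{}_\lambda\,v_{\bar 0}=c\,v_{\bar 0}$, $W_0\,{}_\lambda\,v_{\bar 0}=d\,v_{\bar 0}$, $G_0\,{}_\lambda\,v_{\bar 0}=\sigma v_{\bar 1}$; $\;L_0\,{}_\lambda\,v_{\bar 1}=p(\partial+(a+1)\lambda+b)v_{\bar 1}$, $L_1\,{}_\lambda\,v_{\bar 1}=c\,v_{\bar 1}$, $W_0\,{}_\lambda\,v_{\bar 1}=(d+1)v_{\bar 1}$. * $V_{a,b,\sigma}$: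 $\;L_0\,{}_\lambda\,v_{\bar 0}=p(\partial+a\lambda+b)v_{\bar 0}$, $W_0\,{}_\lambda\,v_{\bar 0}=(a-1)v_{\bar 0}$, $G_0\,{}_\lambda\,v_{\bar 0}=\sigma(\partial+a\lambda+b)v_{\bar 1}$; $\;L_0\,{}_\lambda\,v_{\bar 1}=p(\partial+a\lambda+b)v_{\bar 1}$, $W_0\,{}_\lambda\,v_{\bar 1}=a\,v_{\bar 1}$. For a conformal module $V=V_{\bar 0}\oplus V_{\bar 1}$ let $\Pi(V)$ be the same module with the even and odd parts exchanged. **Theorem.** Let $V=V_{\bar 0}\oplus V_{\bar 1}$ be a conformal $\mathcal{S}(p)$-module that is free over $\mathbb{C}[\partial]$ of rank $1+1$ (that is, $V_{\bar 0}$ and $V_{\bar 1}$ both have rank $1$), and suppose that $V$ is non-trivial in each parity: $\mathcal{S}(p)$ acts neither on $V_{\bar 0}$ nor on $V_{\bar 1}$ by zero. Then $V$ is isomorphic, by a parity-preserving isomorphism of conformal modules, to one of $$V_{a,b,c,d,a',b',c',d'},\quad V_{a,b,c,d,\sigma},\quad V_{a,b,\sigma},\quad \Pi(V_{a-1,b,c,d-1,\sigma}),\quad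 \Pi(V_{a,b,\sigma})$$ for some $a,b,c,d,a',b',c',d'\in\mathbb{C}$ and $\sigma\in\mathbb{C}\setminus\{0\}$, where $c=c'=0$ unless $p=-1$. -/

import Mathlib

open Polynomial

namespace LieConformal

/-! ### `λ`-polynomials

For a `ℂ[∂]`-module `M` (with `∂` the variable `X` of `ℂ[X]`), the space `M[λ] = ℂ[λ] ⊗ M` is
`ℕ →₀ M`: the value of `q` at `k` is the coefficient of `λ ^ k`. -/

section Substitution

variable {M : Type*} [AddCommGroup M] [Module ℂ M] [Module ℂ[X] M] [IsScalarTower ℂ ℂ[X] M]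

/-- Substitution `λ ↦ r(∂)` in an element `q = ∑ λ ^ k q_k` of `M[λ]`, giving `∑ r(∂) ^ k q_k`.
For `r = C z` this is the value of `q` at the complex number `z`. An element of `M[λ]` is
determined by its values at all complex numbers, and likewise for `M[λ, μ]`, so that the identities
between polynomials below are written as identities between their values. -/
noncomputable def subst (r : ℂ[X]) : (ℕ →₀ M) →ₗ[ℂ] M :=
  Finsupp.lsum ℂ fun k => Algebra.lsmul ℂ ℂ M (r ^ k)

end Substitution

/-- The sign `(-1) ^ (|a| |b|)` for parities `|a| = α`, `|b| = β`. -/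
def paritySign (α β : ZMod 2) : ℂ := if α = 1 ∧ β = 1 then -1 else 1

/-- A Lie conformal superalgebra structure on a `ℂ[∂]`-module `S`; `bracket a b` is `[a_λ b]`. -/
structure LieConformalSuperalgebra (S : Type*) [AddCommGroup S] [Module ℂ S] [Module ℂ[X] S]
    [IsScalarTower ℂ ℂ[X] S] where
  /-- the even part `part 0` and the odd part `part 1` -/
  part : ZMod 2 → Submodule ℂ[X] S
  isCompl : IsCompl (part 0) (part 1)
  bracket : S →ₗ[ℂ] S →ₗ[ℂ] (ℕ →₀ S)
  bracket_mem : ∀ (α β : ZMod 2), ∀ a ∈ part α, ∀ b ∈ part β, ∀ k, bracket a b k ∈ part (α + β)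
  /-- `[∂a_λ b] = -λ [a_λ b]` -/
  bracket_del_left : ∀ (a b : S) (z : ℂ),
    subst (C z) (bracket ((X : ℂ[X]) • a) b) = -(z • subst (C z) (bracket a b))
  /-- `[a_λ ∂b] = (∂ + λ) [a_λ b]` -/
  bracket_del_right : ∀ (a b : S) (z : ℂ),
    subst (C z) (bracket a ((X : ℂ[X]) • b)) = (X + C z) • subst (C z) (bracket a b)
  /-- `[a_λ b] = -(-1) ^ (|a| |b|) [b_{-λ-∂} a]` -/
  bracket_skew : ∀ (α β : ZMod 2), ∀ a ∈ part α, ∀ b ∈ part β, ∀ z : ℂ,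
    subst (C z) (bracket a b) = -(paritySign α β • subst (-C z - X) (bracket b a))
  /-- `[a_λ [b_μ c]] = [[a_λ b]_{λ+μ} c] + (-1) ^ (|a| |b|) [b_μ [a_λ c]]` -/
  jacobi : ∀ (α β : ZMod 2), ∀ a ∈ part α, ∀ b ∈ part β, ∀ (c : S) (z w : ℂ),
    subst (C z) (bracket a (subst (C w) (bracket b c))) =
      subst (C (z + w)) (bracket (subst (C z) (bracket a b)) c) +
        paritySign α β • subst (C w) (bracket b (subst (C z) (bracket a c)))

/-- A conformal module structure on a `ℂ[∂]`-module `M` over a Lie conformal superalgebra;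
`act a v` is `a_λ v`. -/
structure ConformalModule {S : Type*} [AddCommGroup S] [Module ℂ S] [Module ℂ[X] S]
    [IsScalarTower ℂ ℂ[X] S] (A : LieConformalSuperalgebra S)
    (M : Type*) [AddCommGroup M] [Module ℂ M] [Module ℂ[X] M] [IsScalarTower ℂ ℂ[X] M] where
  /-- the even part `part 0` and the odd part `part 1` -/
  part : ZMod 2 → Submodule ℂ[X] M
  isCompl : IsCompl (part 0) (part 1)
  act : S →ₗ[ℂ] M →ₗ[ℂ] (ℕ →₀ M)
  act_mem : ∀ (α β : ZMod 2), ∀ a ∈ A.part α, ∀ v ∈ part β, ∀ k, act a v k ∈ part (α + β)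
  /-- `(∂a)_λ v = -λ (a_λ v)` -/
  act_del_left : ∀ (a : S) (v : M) (z : ℂ),
    subst (C z) (act ((X : ℂ[X]) • a) v) = -(z • subst (C z) (act a v))
  /-- `a_λ (∂v) = (∂ + λ) (a_λ v)` -/
  act_del_right : ∀ (a : S) (v : M) (z : ℂ),
    subst (C z) (act a ((X : ℂ[X]) • v)) = (X + C z) • subst (C z) (act a v)
  /-- `a_λ (b_μ v) - (-1) ^ (|a| |b|) b_μ (a_λ v) = [a_λ b]_{λ+μ} v` -/
  jacobi : ∀ (α β : ZMod 2), ∀ a ∈ A.part α, ∀ b ∈ A.part β, ∀ (v : M) (z w : ℂ),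
    subst (C z) (act a (subst (C w) (act b v))) -
        paritySign α β • subst (C w) (act b (subst (C z) (act a v))) =
      subst (C (z + w)) (act (subst (C z) (A.bracket a b)) v)

namespace ConformalModule

variable {S : Type*} [AddCommGroup S] [Module ℂ S] [Module ℂ[X] S] [IsScalarTower ℂ ℂ[X] S]
  {A : LieConformalSuperalgebra S}
  {M : Type*} [AddCommGroup M] [Module ℂ M] [Module ℂ[X] M] [IsScalarTower ℂ ℂ[X] M]
  {N : Type*} [AddCommGroup N] [Module ℂ N] [Module ℂ[X] N] [IsScalarTower ℂ ℂ[X] N]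

/-- The parity change `Π(V)`: the same `λ`-action, with the even and odd parts exchanged. -/
def parityChange (V : ConformalModule A M) : ConformalModule A M where
  part i := V.part (i + 1)
  isCompl := V.isCompl.symm
  act := V.act
  act_mem α β a ha v hv k := by
    have := V.act_mem α (β + 1) a ha v hv k
    rwa [← add_assoc] at this
  act_del_left := V.act_del_left
  act_del_right := V.act_del_right
  jacobi := V.jacobi

/-- `V ≅ W`: there is a parity preserving isomorphism of `ℂ[∂]`-modules that commutes with the
`λ`-actions. -/
def Isomorphic (V : ConformalModule A M) (W : ConformalModule A N) : Prop :=
  ∃ e : M ≃ₗ[ℂ[X]] N, (∀ i, ∀ v ∈ V.part i, e v ∈ W.part i) ∧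
    ∀ (a : S) (v : M) (k : ℕ), W.act a (e v) k = e (V.act a v k)

/-- `V` is free over `ℂ[∂]` of rank `m + n`: its even part has rank `m`, its odd part rank `n`. -/
def IsFreeOfRank (V : ConformalModule A M) (m n : ℕ) : Prop :=
  Module.Free ℂ[X] M ∧ Module.rank ℂ[X] (V.part 0) = m ∧ Module.rank ℂ[X] (V.part 1) = n

/-- The superalgebra acts non-trivially on the part of `V` of parity `i`. -/
def ActsNontriviallyOn (V : ConformalModule A M) (i : ZMod 2) : Prop :=
  ∃ a : S, ∃ v ∈ V.part i, V.act a v ≠ 0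

end ConformalModule

/-! ### `λ`-actions between free `ℂ[∂]`-modules

Elements of `ℂ[∂, λ]` are elements of `ℂ[X][X]`: `∂` is the inner, `λ` the outer variable. -/

/-- `∂` in `ℂ[∂, λ]` -/
noncomputable abbrev del : ℂ[X][X] := C X

/-- `λ` in `ℂ[∂, λ]` -/
noncomputable abbrev lam : ℂ[X][X] := X

/-- the constant `c` in `ℂ[∂, λ]` -/
noncomputable abbrev cst (c : ℂ) : ℂ[X][X] := C (C c)

section FreeAction

variable {ι κ : Type*}

/-- `Q(∂, λ) ↦ Q(∂, λ) y` for a basis element `y`. -/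
noncomputable def toLam (y : κ) : ℂ[X][X] →ₗ[ℂ] (ℕ →₀ (κ →₀ ℂ[X])) where
  toFun Q := Finsupp.onFinset Q.support (fun n => Finsupp.single y (Q.coeff n)) (by
    intro n hn
    rw [mem_support_iff]
    rintro h
    exact hn (by simp [h]))
  map_add' Q R := by ext; simp
  map_smul' c Q := by ext n : 1; simp

/-- `f(∂) ↦ f(-λ)` -/
noncomputable def leftFactor : ℂ[X] →ₐ[ℂ] ℂ[X][X] := aeval (-lam)

/-- `g(∂) ↦ g(∂ + λ)` -/
noncomputable def rightFactor : ℂ[X] →ₐ[ℂ] ℂ[X][X] := aeval (del + lam)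

/-- The `λ`-action of the free `ℂ[∂]`-module with basis `ι` on the free `ℂ[∂]`-module with basis `κ`
with `x_λ y = P x y (∂, λ) (t x y)` for basis elements, extended by the rule
`(f(∂) x)_λ (g(∂) y) = f(-λ) g(∂ + λ) (x_λ y)`. -/
noncomputable def freeAct (t : ι → κ → κ) (P : ι → κ → ℂ[X][X]) :
    (ι →₀ ℂ[X]) →ₗ[ℂ] (κ →₀ ℂ[X]) →ₗ[ℂ] (ℕ →₀ (κ →₀ ℂ[X])) :=
  Finsupp.lsum ℂ fun x => LinearMap.flip (Finsupp.lsum ℂ fun y => LinearMap.flip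
    (((LinearMap.mul ℂ ℂ[X][X]).compl₁₂ leftFactor.toLinearMap rightFactor.toLinearMap).compr₂
      (toLam (t x y) ∘ₗ LinearMap.mulRight ℂ (P x y))))

theorem freeAct_single (t : ι → κ → κ) (P : ι → κ → ℂ[X][X]) (x : ι) (y : κ) (f g : ℂ[X]) :
    freeAct t P (Finsupp.single x f) (Finsupp.single y g) =
      toLam (t x y) (leftFactor f * rightFactor g * P x y) := by
  simp [freeAct]

theorem subst_toLam (r : ℂ[X]) (y : κ) (Q : ℂ[X][X]) :
    subst r (toLam y Q) = Finsupp.single y (Q.eval r) := by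
  simp only [subst, toLam, Finsupp.lsum_apply, LinearMap.coe_mk, AddHom.coe_mk]
  rw [Finsupp.onFinset_sum _ (by simp), eval_eq_sum, Polynomial.sum, Finsupp.single_finsetSum]
  refine Finset.sum_congr rfl fun n _ => ?_
  change r ^ n • Finsupp.single y (Q.coeff n) = _
  rw [Finsupp.smul_single, smul_eq_mul, mul_comm]

theorem subst_freeAct (t : ι → κ → κ) (P : ι → κ → ℂ[X][X]) (r : ℂ[X]) (x : ι) (y : κ)
    (f g : ℂ[X]) :
    subst r (freeAct t P (Finsupp.single x f) (Finsupp.single y g)) =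
      Finsupp.single (t x y) (f.comp (-r) * g.comp (X + r) * (P x y).eval r) := by
  have h1 : (leftFactor f).eval r = f.comp (-r) := by
    induction f using Polynomial.induction_on' with
    | add p q hp hq => simp [hp, hq]
    | monomial n a => simp [leftFactor, aeval_monomial, Polynomial.algebraMap_apply]
  have h2 : (rightFactor g).eval r = g.comp (X + r) := by
    induction g using Polynomial.induction_on' with
    | add p q hp hq => simp [hp, hq]
    | monomial n a => simp [rightFactor, aeval_monomial, Polynomial.algebraMap_apply]
  rw [freeAct_single, subst_toLam, eval_mul, eval_mul, h1, h2]


/-- The span over `ℂ[∂]` of the basis elements of parity `α`. -/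
noncomputable def freePart (par : ι → ZMod 2) (α : ZMod 2) : Submodule ℂ[X] (ι →₀ ℂ[X]) :=
  Finsupp.supported ℂ[X] ℂ[X] {x | par x = α}

theorem single_mem_freePart (par : ι → ZMod 2) (x : ι) (f : ℂ[X]) :
    Finsupp.single x f ∈ freePart par (par x) :=
  Finsupp.single_mem_supported ℂ[X] f rfl

theorem freePart_isCompl (par : ι → ZMod 2) : IsCompl (freePart par 0) (freePart par 1) := by
  refine ⟨Finsupp.disjoint_supported_supported ?_, Finsupp.codisjoint_supported_supported ?_⟩
  · rw [Set.disjoint_left]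
    intro x hx hx'
    simp only [Set.mem_ofPred_eq] at hx hx'
    rw [hx] at hx'
    exact absurd hx' (by decide)
  · refine codisjoint_iff.2 (Set.eq_univ_iff_forall.2 fun x => ?_)
    have : ∀ i : ZMod 2, i = 0 ∨ i = 1 := by decide
    exact this (par x)

theorem freePart_induction {par : ι → ZMod 2} {α : ZMod 2} {p : (ι →₀ ℂ[X]) → Prop}
    (h0 : p 0) (hadd : ∀ a b, p a → p b → p (a + b))
    (hs : ∀ x, par x = α → ∀ f, p (Finsupp.single x f)) {a : ι →₀ ℂ[X]}
    (ha : a ∈ freePart par α) : p a := by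
  rw [← Finsupp.sum_single a, Finsupp.sum]
  refine Finset.sum_induction _ p hadd h0 fun x hx => hs x ?_ _
  exact (Finsupp.mem_supported ℂ[X] a).1 ha hx

theorem freeAct_mem (t : ι → κ → κ) (P : ι → κ → ℂ[X][X]) (par : ι → ZMod 2)
    (par' : κ → ZMod 2) (ht : ∀ x y, par' (t x y) = par x + par' y) (α β : ZMod 2)
    (a : ι →₀ ℂ[X]) (ha : a ∈ freePart par α) (v : κ →₀ ℂ[X]) (hv : v ∈ freePart par' β) (k : ℕ) :
    freeAct t P a v k ∈ freePart par' (α + β) := by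
  revert v
  refine freePart_induction (p := fun a => ∀ v ∈ freePart par' β,
    freeAct t P a v k ∈ freePart par' (α + β)) ?_ ?_ ?_ ha
  · intro v _
    simp
  · intro a b iha ihb v hv
    simpa using add_mem (iha v hv) (ihb v hv)
  · intro x hx f v hv
    refine freePart_induction (p := fun v =>
      freeAct t P (Finsupp.single x f) v k ∈ freePart par' (α + β)) ?_ ?_ ?_ hv
    · simp
    · intro a b iha ihb
      simpa using add_mem iha ihb
    · intro y hy g
      rw [freeAct_single, ← hx, ← hy, ← ht]
      exact single_mem_freePart par' _ _

theorem freeAct_del_left (t : ι → κ → κ) (P : ι → κ → ℂ[X][X]) (a : ι →₀ ℂ[X]) (v : κ →₀ ℂ[X])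
    (z : ℂ) : subst (C z) (freeAct t P ((X : ℂ[X]) • a) v) =
      -(z • subst (C z) (freeAct t P a v)) := by
  induction a using Finsupp.induction_linear with
  | zero => simp
  | add a b ha hb => simp only [smul_add, map_add, LinearMap.add_apply, ha, hb, neg_add]
  | single x f =>
    induction v using Finsupp.induction_linear with
    | zero => simp
    | add a b ha hb => simp only [smul_add, map_add, ha, hb, neg_add]
    | single y g =>
      rw [Finsupp.smul_single, subst_freeAct, subst_freeAct, Finsupp.smul_single,
        ← Finsupp.single_neg]
      congr 1
      simp only [smul_eq_mul, mul_comp, X_comp, Polynomial.smul_eq_C_mul]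
      ring

theorem freeAct_del_right (t : ι → κ → κ) (P : ι → κ → ℂ[X][X]) (a : ι →₀ ℂ[X]) (v : κ →₀ ℂ[X])
    (z : ℂ) : subst (C z) (freeAct t P a ((X : ℂ[X]) • v)) =
      (X + C z) • subst (C z) (freeAct t P a v) := by
  induction a using Finsupp.induction_linear with
  | zero => simp
  | add a b ha hb => simp only [smul_add, map_add, LinearMap.add_apply, ha, hb]
  | single x f =>
    induction v using Finsupp.induction_linear with
    | zero => simp
    | add a b ha hb => simp only [smul_add, map_add, ha, hb]
    | single y g =>
      rw [Finsupp.smul_single, subst_freeAct, subst_freeAct, Finsupp.smul_single]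
      congr 1
      simp only [smul_eq_mul, mul_comp, X_comp]
      ring

/-- The module identity for `freeAct` follows from the identity for basis elements. -/
theorem freeAct_jacobi (m : ι → ι → ι) (B : ι → ι → ℂ[X][X]) (t : ι → κ → κ)
    (P : ι → κ → ℂ[X][X]) (par : ι → ZMod 2)
    (h1 : ∀ x x' y, t x (t x' y) = t (m x x') y)
    (h2 : ∀ x x' y, t x' (t x y) = t (m x x') y)
    (h : ∀ x x' y, ∀ z w : ℂ,
      ((P x' y).eval (C w)).comp (X + C z) * (P x (t x' y)).eval (C z) -
        paritySign (par x) (par x') •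
          (((P x y).eval (C z)).comp (X + C w) * (P x' (t x y)).eval (C w)) =
        ((B x x').eval (C z)).comp (-C (z + w)) * (P (m x x') y).eval (C (z + w)))
    (α β : ZMod 2) (a : ι →₀ ℂ[X]) (ha : a ∈ freePart par α) (b : ι →₀ ℂ[X])
    (hb : b ∈ freePart par β) (v : κ →₀ ℂ[X]) (z w : ℂ) :
    subst (C z) (freeAct t P a (subst (C w) (freeAct t P b v))) -
        paritySign α β • subst (C w) (freeAct t P b (subst (C z) (freeAct t P a v))) =
      subst (C (z + w)) (freeAct t P (subst (C z) (freeAct m B a b)) v) := by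
  obtain ⟨s, hs⟩ : ∃ s, s = z + w := ⟨_, rfl⟩
  rw [← hs]
  revert b
  refine freePart_induction (p := fun a => ∀ b ∈ freePart par β,
    subst (C z) (freeAct t P a (subst (C w) (freeAct t P b v))) -
        paritySign α β • subst (C w) (freeAct t P b (subst (C z) (freeAct t P a v))) =
      subst (C s) (freeAct t P (subst (C z) (freeAct m B a b)) v)) ?_ ?_ ?_ ha
  · intro b _
    simp
  · intro a a' iha iha' b hb
    simp only [map_add, LinearMap.add_apply, smul_add]
    rw [add_sub_add_comm, iha b hb, iha' b hb]
  intro x hx f b hb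
  refine freePart_induction (p := fun b =>
    subst (C z) (freeAct t P (Finsupp.single x f) (subst (C w) (freeAct t P b v))) -
        paritySign α β •
          subst (C w) (freeAct t P b (subst (C z) (freeAct t P (Finsupp.single x f) v))) =
      subst (C s) (freeAct t P (subst (C z) (freeAct m B (Finsupp.single x f) b)) v))
    ?_ ?_ ?_ hb
  · simp
  · intro a a' iha iha'
    simp only [map_add, LinearMap.add_apply, smul_add]
    rw [add_sub_add_comm, iha, iha']
  intro x' hx' g
  induction v using Finsupp.induction_linear with
  | zero => simp
  | add a a' iha iha' =>
    simp only [map_add, smul_add]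
    rw [add_sub_add_comm, iha, iha']
  | single y k =>
    simp only [subst_freeAct]
    rw [h1 x x' y, h2 x x' y, Finsupp.smul_single, ← Finsupp.single_sub]
    congr 1
    have := h x x' y z w
    rw [hx, hx', ← hs] at this
    have e1 : ∀ q : ℂ[X], (q.comp (-C w)).comp (X + C z) = q.comp (-C w) := fun q => by
      simp [comp_assoc]
    have e2 : ∀ q : ℂ[X], (q.comp (-C z)).comp (X + C w) = q.comp (-C z) := fun q => by
      simp [comp_assoc]
    have e3 : ∀ q : ℂ[X], (q.comp (X + C w)).comp (X + C z) = q.comp (X + C s) := fun q => by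
      simp [comp_assoc, hs, add_assoc]
    have e4 : ∀ q : ℂ[X], (q.comp (X + C z)).comp (X + C w) = q.comp (X + C s) := fun q => by
      rw [comp_assoc, hs, C_add]
      simp [add_comm, add_left_comm]
    have e5 : ∀ q : ℂ[X], (q.comp (-C z)).comp (-C s) = q.comp (-C z) := fun q => by
      simp [comp_assoc]
    have e6 : ∀ q : ℂ[X], (q.comp (X + C z)).comp (-C s) = q.comp (-C w) := fun q => by
      simp [comp_assoc, hs]
    simp only [mul_comp, e1, e2, e3, e4, e5, e6]
    rw [Polynomial.smul_eq_C_mul] at this ⊢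
    linear_combination (f.comp (-C z) * g.comp (-C w) * k.comp (X + C s)) * this

end FreeAction

/-! ### The Lie conformal superalgebra `𝒮(p)` -/

/-- The three families of generators `L_i`, `W_i`, `G_i`. -/
inductive Kind
  | L | W | G

/-- The generators of `𝒮(p)`: `(Kind.L, i)` is `L_i`, and so on. -/
abbrev Gen := Kind × ℕ

/-- `L_i` and `W_i` are even, `G_i` is odd. -/
def Kind.parity : Kind → ZMod 2
  | .L => 0
  | .W => 0
  | .G => 1

/-- The family in which the bracket of two generators lies
(the values at `W, W` and `G, G` do not matter, as these brackets vanish). -/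
def Kind.target : Kind → Kind → Kind
  | .L, k => k
  | k, .L => k
  | .W, .W => .W
  | .W, .G => .G
  | .G, .W => .G
  | .G, .G => .W

theorem Kind.parity_target (k l : Kind) : (k.target l).parity = k.parity + l.parity := by
  cases k <;> cases l <;> decide

theorem Kind.target_comm (k l : Kind) : k.target l = l.target k := by
  cases k <;> cases l <;> rfl

theorem Kind.target_assoc (k l m : Kind) : (k.target l).target m = k.target (l.target m) := by
  cases k <;> cases l <;> cases m <;> rfl

/-- The bracket of two generators is a multiple of this generator. -/
def Gen.target (x y : Gen) : Gen := (x.1.target y.1, x.2 + y.2)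

/-- The coefficient in `ℂ[∂, λ]` of the bracket of two generators of `𝒮(p)`. -/
noncomputable def bracketCoeff (p : ℂ) : Gen → Gen → ℂ[X][X]
  | (.L, i), (.L, j) => cst (i + p) * del + cst (i + j + 2 * p) * lam
  | (.L, i), (.W, j) => cst (i + p) * del + cst (i + j + p) * lam
  | (.L, i), (.G, j) => cst (i + p) * del + cst (i + j + 2 * p) * lam
  | (.W, _), (.G, _) => 1
  | (.W, _), (.W, _) => 0
  | (.G, _), (.G, _) => 0
  -- the remaining brackets are determined by skew-symmetry
  | (.W, i), (.L, j) => cst i * del + cst (i + j + p) * lam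
  | (.G, i), (.L, j) => cst (i + p) * del + cst (i + j + 2 * p) * lam
  | (.G, _), (.W, _) => -1

theorem bracketCoeff_skew (p : ℂ) (x y : Gen) (z : ℂ) :
    (bracketCoeff p x y).eval (C z) =
      -(C (paritySign x.1.parity y.1.parity) * (bracketCoeff p y x).eval (-C z - X)) := by
  have h2 : (C 2 : ℂ[X]) = 2 := rfl
  obtain ⟨k, i⟩ := x
  obtain ⟨l, j⟩ := y
  cases k <;> cases l <;> simp [bracketCoeff, paritySign, Kind.parity, h2] <;> ring

theorem bracketCoeff_jacobi (p : ℂ) (x x' y : Gen) (z w : ℂ) :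
    ((bracketCoeff p x' y).eval (C w)).comp (X + C z) *
        (bracketCoeff p x (Gen.target x' y)).eval (C z) -
      paritySign x.1.parity x'.1.parity •
        (((bracketCoeff p x y).eval (C z)).comp (X + C w) *
          (bracketCoeff p x' (Gen.target x y)).eval (C w)) =
      ((bracketCoeff p x x').eval (C z)).comp (-C (z + w)) *
        (bracketCoeff p (Gen.target x x') y).eval (C (z + w)) := by
  have h2 : (C 2 : ℂ[X]) = 2 := rfl
  rw [Polynomial.smul_eq_C_mul]
  obtain ⟨k, i⟩ := x
  obtain ⟨l, j⟩ := x'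
  obtain ⟨m, n⟩ := y
  cases k <;> cases l <;> cases m <;>
    simp [Gen.target, Kind.target, bracketCoeff, paritySign, Kind.parity, h2] <;> ring

/-- The Lie conformal superalgebra `𝒮(p)`, the free `ℂ[∂]`-module on `L_i`, `W_i`, `G_i`, `i ≥ 0`. -/
noncomputable def superBlock (p : ℂ) : LieConformalSuperalgebra (Gen →₀ ℂ[X]) where
  part := freePart fun x => x.1.parity
  isCompl := freePart_isCompl _
  bracket := freeAct Gen.target (bracketCoeff p)
  bracket_mem := freeAct_mem _ _ _ _ (fun _ _ => Kind.parity_target _ _)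
  bracket_del_left := freeAct_del_left _ _
  bracket_del_right := freeAct_del_right _ _
  bracket_skew := by
    intro α β a ha b hb z
    revert b
    refine freePart_induction (p := fun a => ∀ b ∈ freePart (fun x : Gen => x.1.parity) β,
      subst (C z) (freeAct Gen.target (bracketCoeff p) a b) =
        -(paritySign α β • subst (-C z - X) (freeAct Gen.target (bracketCoeff p) b a)))
      ?_ ?_ ?_ ha
    · simp
    · intro a a' iha iha' b hb
      simp only [map_add, LinearMap.add_apply, smul_add, iha b hb, iha' b hb, neg_add]
    intro x hx f b hb
    refine freePart_induction (p := fun b =>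
      subst (C z) (freeAct Gen.target (bracketCoeff p) (Finsupp.single x f) b) =
        -(paritySign α β •
          subst (-C z - X) (freeAct Gen.target (bracketCoeff p) b (Finsupp.single x f))))
      ?_ ?_ ?_ hb
    · simp
    · intro a a' iha iha'
      simp only [map_add, LinearMap.add_apply, smul_add, iha, iha', neg_add]
    intro y hy g
    have ht : Gen.target y x = Gen.target x y := by
      simp [Gen.target, Kind.target_comm, add_comm]
    rw [subst_freeAct, subst_freeAct, ht, Finsupp.smul_single, ← Finsupp.single_neg]
    congr 1
    have e1 : X + (-C z - X) = -C z := by ring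
    have e2 : -(-C z - X) = X + C z := by ring
    have key : (bracketCoeff p x y).eval (C z) =
        -(C (paritySign α β) * (bracketCoeff p y x).eval (-C z - X)) := by
      rw [← hx, ← hy]
      exact bracketCoeff_skew p x y z
    rw [e1, e2, key, Polynomial.smul_eq_C_mul]
    ring
  jacobi := by
    intro α β a ha b hb c z w
    rw [← sub_eq_iff_eq_add]
    refine freeAct_jacobi Gen.target (bracketCoeff p) Gen.target (bracketCoeff p)
      (fun x => x.1.parity) ?_ ?_ (bracketCoeff_jacobi p) α β a ha b hb c z w
    · intro x x' y
      simp [Gen.target, Kind.target_assoc, add_assoc]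
    · intro x x' y
      simp [Gen.target, Kind.target_assoc, Kind.target_comm x.1 x'.1, add_left_comm, add_assoc]

/-! ### The modules of rank `1 + 1` -/

/-- The generator of `ℂ[∂] v_0 ⊕ ℂ[∂] v_1` to which `x` maps `v_i`, up to a coefficient. -/
def pairTarget (x : Gen) (i : ZMod 2) : ZMod 2 := x.1.parity + i

/-- The module identity for the generators of `𝒮(p)`, acting on `v_0`, `v_1` by `P`. -/
def PairIdentity (p : ℂ) (P : Gen → ZMod 2 → ℂ[X][X]) : Prop :=
  ∀ (x x' : Gen) (i : ZMod 2) (z w : ℂ),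
      ((P x' i).eval (C w)).comp (X + C z) * (P x (pairTarget x' i)).eval (C z) -
        paritySign x.1.parity x'.1.parity •
          (((P x i).eval (C z)).comp (X + C w) * (P x' (pairTarget x i)).eval (C w)) =
        ((bracketCoeff p x x').eval (C z)).comp (-C (z + w)) *
          (P (x.target x') i).eval (C (z + w))

/-- The conformal `𝒮(p)`-module `ℂ[∂] v_0 ⊕ ℂ[∂] v_1`, `v_i` of parity `i`, on which a generator `x`
acts by `x_λ v_i = P x i (∂, λ) v_{i + |x|}`; `h` is the module identity for generators. -/
noncomputable def pairModule (p : ℂ) (P : Gen → ZMod 2 → ℂ[X][X])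
    (h : PairIdentity p P) :
    ConformalModule (superBlock p) (ZMod 2 →₀ ℂ[X]) where
  part := freePart id
  isCompl := freePart_isCompl _
  act := freeAct pairTarget P
  act_mem := freeAct_mem _ _ _ _ (fun _ _ => rfl)
  act_del_left := freeAct_del_left _ _
  act_del_right := freeAct_del_right _ _
  jacobi := by
    refine freeAct_jacobi Gen.target (bracketCoeff p) pairTarget P (fun x => x.1.parity) ?_ ?_ h
    · intro x x' y
      simp [pairTarget, Gen.target, Kind.parity_target, add_assoc]
    · intro x x' y
      simp [pairTarget, Gen.target, Kind.parity_target, add_left_comm, add_assoc]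

/-- The coefficients of the action of the generators in `V_{a,b,c,d,a',b',c',d'}`. -/
noncomputable def sumCoeff (p a b c d a' b' c' d' : ℂ) : Gen → ZMod 2 → ℂ[X][X]
  | (.L, 0), i => if i = 0 then cst p * (del + cst a * lam + cst b)
      else cst p * (del + cst a' * lam + cst b')
  | (.L, 1), i => if i = 0 then cst c else cst c'
  | (.L, _ + 2), _ => 0
  | (.W, 0), i => if i = 0 then cst d else cst d'
  | (.W, _ + 1), _ => 0
  | (.G, _), _ => 0

/-- The coefficients of the action of the generators in `V_{a,b,c,d,σ}`. -/
noncomputable def constCoeff (p a b c d σ : ℂ) : Gen → ZMod 2 → ℂ[X][X]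
  | (.L, 0), i => if i = 0 then cst p * (del + cst a * lam + cst b)
      else cst p * (del + cst (a + 1) * lam + cst b)
  | (.L, 1), _ => cst c
  | (.L, _ + 2), _ => 0
  | (.W, 0), i => if i = 0 then cst d else cst (d + 1)
  | (.W, _ + 1), _ => 0
  | (.G, 0), i => if i = 0 then cst σ else 0
  | (.G, _ + 1), _ => 0

/-- The coefficients of the action of the generators in `V_{a,b,σ}`. -/
noncomputable def linCoeff (p a b σ : ℂ) : Gen → ZMod 2 → ℂ[X][X]
  | (.L, 0), _ => cst p * (del + cst a * lam + cst b)
  | (.L, _ + 1), _ => 0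
  | (.W, 0), i => if i = 0 then cst (a - 1) else cst a
  | (.W, _ + 1), _ => 0
  | (.G, 0), i => if i = 0 then cst σ * (del + cst a * lam + cst b) else 0
  | (.G, _ + 1), _ => 0

theorem sumCoeff_zero_of_le (p a b c d a' b' c' d' : ℂ) (k : Kind) (m : ℕ) (i : ZMod 2) :
    sumCoeff p a b c d a' b' c' d' (k, m + 2) i = 0 := by
  cases k <;> rfl

theorem sumCoeff_identity (p a b c d a' b' c' d' : ℂ) (h : p ≠ -1 → c = 0 ∧ c' = 0) :
    PairIdentity p (sumCoeff p a b c d a' b' c' d') := by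
  have h2 : (C 2 : ℂ[X]) = 2 := rfl
  have hc : C p * C c = -C c := by
    rw [← C_mul, ← C_neg]
    by_cases hp : p = -1
    · simp [hp]
    · simp [(h hp).1]
  have hc' : C p * C c' = -C c' := by
    rw [← C_mul, ← C_neg]
    by_cases hp : p = -1
    · simp [hp]
    · simp [(h hp).2]
  have hz : ∀ k l m n i, sumCoeff p a b c d a' b' c' d' (Gen.target (k, m + 2) (l, n)) i = 0 := fun k l m n i => by
    rw [← sumCoeff_zero_of_le p a b c d a' b' c' d' (k.target l) (m + n) i]
    simp [Gen.target, add_right_comm]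
  have hz' : ∀ k l m n i, sumCoeff p a b c d a' b' c' d' (Gen.target (k, m) (l, n + 2)) i = 0 := fun k l m n i => by
    rw [← sumCoeff_zero_of_le p a b c d a' b' c' d' (k.target l) (m + n) i]
    simp [Gen.target, add_assoc]
  rintro ⟨k, m⟩ ⟨l, n⟩ i z w
  have hi : i = 0 ∨ i = 1 := by
    revert i
    decide
  rw [Polynomial.smul_eq_C_mul]
  rcases m with _ | _ | m
  rotate_left 2
  · simp [hz, sumCoeff_zero_of_le]
  all_goals
    rcases n with _ | _ | n
    rotate_left 2
    · simp [hz', sumCoeff_zero_of_le]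
  all_goals
    rcases hi with rfl | rfl <;> cases k <;> cases l <;>
    simp [sumCoeff, pairTarget, Gen.target, Kind.target, bracketCoeff, paritySign, Kind.parity, h2] <;>
    first
      | ring1
      | linear_combination (C z) * hc
      | linear_combination -(C z) * hc
      | linear_combination (C w) * hc
      | linear_combination -(C w) * hc
      | linear_combination (C z) * hc'
      | linear_combination -(C z) * hc'
      | linear_combination (C w) * hc'


theorem constCoeff_zero_of_le (p a b c d σ : ℂ) (k : Kind) (m : ℕ) (i : ZMod 2) :
    constCoeff p a b c d σ (k, m + 2) i = 0 := by
  cases k <;> rfl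

theorem constCoeff_identity (p a b c d σ : ℂ) (h : p ≠ -1 → c = 0) :
    PairIdentity p (constCoeff p a b c d σ) := by
  have h2 : (C 2 : ℂ[X]) = 2 := rfl
  have hc : C p * C c = -C c := by
    rw [← C_mul, ← C_neg]
    by_cases hp : p = -1
    · simp [hp]
    · simp [h hp]
  have hz : ∀ k l m n i, constCoeff p a b c d σ (Gen.target (k, m + 2) (l, n)) i = 0 := fun k l m n i => by
    rw [← constCoeff_zero_of_le p a b c d σ (k.target l) (m + n) i]
    simp [Gen.target, add_right_comm]
  have hz' : ∀ k l m n i, constCoeff p a b c d σ (Gen.target (k, m) (l, n + 2)) i = 0 := fun k l m n i => by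
    rw [← constCoeff_zero_of_le p a b c d σ (k.target l) (m + n) i]
    simp [Gen.target, add_assoc]
  rintro ⟨k, m⟩ ⟨l, n⟩ i z w
  have hi : i = 0 ∨ i = 1 := by
    revert i
    decide
  rw [Polynomial.smul_eq_C_mul]
  rcases m with _ | _ | m
  rotate_left 2
  · simp [hz, constCoeff_zero_of_le]
  all_goals
    rcases n with _ | _ | n
    rotate_left 2
    · simp [hz', constCoeff_zero_of_le]
  all_goals
    rcases hi with rfl | rfl <;> cases k <;> cases l <;>
    simp [constCoeff, pairTarget, Gen.target, Kind.target, bracketCoeff, paritySign, Kind.parity, h2] <;>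
    first
      | ring1
      | linear_combination (C z) * hc
      | linear_combination -(C z) * hc
      | linear_combination (C w) * hc


theorem linCoeff_zero_of_le (p a b σ : ℂ) (k : Kind) (m : ℕ) (i : ZMod 2) :
    linCoeff p a b σ (k, m + 2) i = 0 := by
  cases k <;> rfl

theorem linCoeff_identity (p a b σ : ℂ) :
    PairIdentity p (linCoeff p a b σ) := by
  have h2 : (C 2 : ℂ[X]) = 2 := rfl
  have hz : ∀ k l m n i, linCoeff p a b σ (Gen.target (k, m + 2) (l, n)) i = 0 := fun k l m n i => by
    rw [← linCoeff_zero_of_le p a b σ (k.target l) (m + n) i]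
    simp [Gen.target, add_right_comm]
  have hz' : ∀ k l m n i, linCoeff p a b σ (Gen.target (k, m) (l, n + 2)) i = 0 := fun k l m n i => by
    rw [← linCoeff_zero_of_le p a b σ (k.target l) (m + n) i]
    simp [Gen.target, add_assoc]
  rintro ⟨k, m⟩ ⟨l, n⟩ i z w
  have hi : i = 0 ∨ i = 1 := by
    revert i
    decide
  rw [Polynomial.smul_eq_C_mul]
  rcases m with _ | _ | m
  rotate_left 2
  · simp [hz, linCoeff_zero_of_le]
  all_goals
    rcases n with _ | _ | n
    rotate_left 2
    · simp [hz', linCoeff_zero_of_le]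
  all_goals
    rcases hi with rfl | rfl <;> cases k <;> cases l <;>
    simp [linCoeff, pairTarget, Gen.target, Kind.target, bracketCoeff, paritySign, Kind.parity, h2] <;>
    first
      | ring1


/-- `V_{a,b,c,d,a',b',c',d'}`. For `p ≠ -1` this is a conformal module only if `c = c' = 0`. -/
noncomputable def sumModule (p a b c d a' b' c' d' : ℂ) (h : p ≠ -1 → c = 0 ∧ c' = 0) :
    ConformalModule (superBlock p) (ZMod 2 →₀ ℂ[X]) :=
  pairModule p (sumCoeff p a b c d a' b' c' d') (sumCoeff_identity p a b c d a' b' c' d' h)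

/-- `V_{a,b,c,d,σ}`. For `p ≠ -1` this is a conformal module only if `c = 0`. -/
noncomputable def constModule (p a b c d σ : ℂ) (h : p ≠ -1 → c = 0) :
    ConformalModule (superBlock p) (ZMod 2 →₀ ℂ[X]) :=
  pairModule p (constCoeff p a b c d σ) (constCoeff_identity p a b c d σ h)

/-- `V_{a,b,σ}`. -/
noncomputable def linModule (p a b σ : ℂ) :
    ConformalModule (superBlock p) (ZMod 2 →₀ ℂ[X]) :=
  pairModule p (linCoeff p a b σ) (linCoeff_identity p a b σ)

end LieConformal

/-!
On a homogeneous basis `v_0`, `v_1` the module is encoded by the bivariate polynomials `P x i` with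
`x_λ v_i = P x i (∂, λ) v_{i + |x|}`, and the module axioms become one identity for each pair of
generators. The identity for `L_0, L_0` forces `L_0` to act by `p (∂ + aλ + b)` or by zero, and if
it acts on `v_i` by zero, then so does every generator. With respect to such an `L_0` each generator
is primary, of conformal weight `2 + j / p` (for `L_j`, `G_j`) or `1 + j / p` (for `W_j`). The
brackets `[L_j λ L_j]` and `[W_j λ W_j]` kill `L_j` unless `j = 0` or its weight is `1`, that is,
`p = -j`, and kill `W_j` unless `j = 0`; `[L_1 λ L_{j-1}]` then removes `L_j` for `j ≥ 2`, and
`[W_j λ G_0] = G_j` removes `G_j` for `j ≥ 1`. If `G_0` acts non-trivially on `v_i`, then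
`[W_0 λ G_0] = G_0` makes the `W_0`-eigenvalue of `v_{i+1}` exceed that of `v_i` by `1`, so `G_0`
kills `v_{i+1}`, and it restricts the action on `v_i` to a constant or a multiple of `∂ + aλ + b`.
-/

namespace LieConformal

section Bivariate

variable {R : Type*} [CommRing R]

theorem evalEval_swap (F : R[X][X]) (x w : R) :
    (Bivariate.swap F).evalEval w x = F.evalEval x w := by
  rw [← coe_aevalAeval_eq_evalEval, ← coe_aevalAeval_eq_evalEval, Bivariate.aevalAeval_swap]

theorem evalEval_taylor_X (F : R[X][X]) (x w : R) :
    (taylor X F).evalEval x w = F.evalEval x (w + x) := by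
  rw [evalEval, taylor_eval, ← coe_evalRingHom, ← eval₂_at_apply, ← eval_map,
    map_evalRingHom_eval]
  simp

theorem evalEval_map_compRingHom_neg_X (F : R[X][X]) (x w : R) :
    (F.map (compRingHom (-X))).evalEval x w = F.evalEval (-x) w := by
  rw [← map_evalRingHom_eval, map_map, ← map_evalRingHom_eval]
  congr 2
  ext <;> simp

theorem exists_eval_add_eq_add_mul (f : R[X]) (x : R) :
    ∃ g : R[X], (∀ z, f.eval (x + z) = f.eval x + z * g.eval z) ∧
      g.eval 0 = f.derivative.eval x := by
  refine ⟨(taylor x f).divX, fun z => ?_, ?_⟩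
  · have := congrArg (eval z) (X_mul_divX_add (taylor x f))
    rw [taylor_eval, taylor_coeff_zero, eval_add, eval_mul, eval_X, eval_C] at this
    rw [add_comm x z, ← this, add_comm]
  · rw [← coeff_zero_eq_eval_zero, coeff_divX, taylor_coeff_one]

variable [IsDomain R]

theorem natDegree_eq_one_of_mul_taylor_eq {G : R[X][X]} {r s k : R[X]}
    (h : G * taylor X (G.map (compRingHom (-X))) = (X + C r) * (X + C s) + C k) :
    G.natDegree = 1 ∧ IsUnit G.leadingCoeff := by
  have injective_neg : Function.Injective (compRingHom (-X : R[X])) :=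
    Function.LeftInverse.injective (g := compRingHom (-X)) fun p => by simp [comp_assoc]
  set G' := taylor X (G.map (compRingHom (-X))) with hG'
  have natDegree_G' : G'.natDegree = G.natDegree := by
    rw [hG', natDegree_taylor, natDegree_map_eq_of_injective injective_neg]
  have rhs_eq : (X + C r) * (X + C s) + C k = C 1 * X ^ 2 + C (r + s) * X + C (r * s + k) := by
    simp only [C_add, C_mul, C_1]
    ring
  have natDegree_mul_eq : (G * G').natDegree = 2 := by
    rw [h, rhs_eq, natDegree_quadratic one_ne_zero]
  have leadingCoeff_mul_eq : (G * G').leadingCoeff = 1 := by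
    rw [h, rhs_eq, leadingCoeff_quadratic one_ne_zero]
  have mul_ne_zero : G * G' ≠ 0 := fun h0 => by simp [h0] at natDegree_mul_eq
  rw [natDegree_mul (left_ne_zero_of_mul mul_ne_zero) (right_ne_zero_of_mul mul_ne_zero),
    natDegree_G'] at natDegree_mul_eq
  rw [leadingCoeff_mul] at leadingCoeff_mul_eq
  exact ⟨by omega, .of_mul_eq_one _ leadingCoeff_mul_eq⟩

section Infinite

variable [Infinite R]

theorem eq_zero_of_evalEval {F : R[X][X]} (h : ∀ x w, F.evalEval x w = 0) : F = 0 :=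
  eq_zero_of_infinite_isRoot F <|
    (Set.infinite_range_of_injective C_injective).mono (s := Set.range (C : R → R[X])) <| by
      rintro _ ⟨w, rfl⟩
      exact Polynomial.funext fun x => by simpa using h x w

theorem ext_evalEval {F H : R[X][X]}
    (h : ∀ x w, F.evalEval x w = H.evalEval x w) : F = H :=
  sub_eq_zero.1 <| eq_zero_of_evalEval fun x w => by rw [evalEval_sub, h, sub_self]

theorem exists_evalEval_ne_zero {F : R[X][X]} (h : F ≠ 0) :
    ∃ x w, F.evalEval x w ≠ 0 := by
  contrapose! h
  exact eq_zero_of_evalEval h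

theorem eval_eq_of_add_mul_eval_eq {p q : R[X]} (c : R)
    (h : ∀ x, (x + c) * p.eval x = (x + c) * q.eval x) (x : R) : p.eval x = q.eval x := by
  have : (X + C c) * p = (X + C c) * q := Polynomial.funext fun x => by simpa using h x
  rw [mul_left_cancel₀ (X_add_C_ne_zero c) this]

end Infinite

variable [CharZero R]

theorem eval_eq_eval_of_periodic {q : R[X]} {w : R} (hw : w ≠ 0)
    (hq : Function.Periodic (fun x => q.eval x) w) (x y : R) : q.eval x = q.eval y := by
  suffices h : q = C (q.eval 0) by rw [h, eval_C, eval_C]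
  refine eq_of_infinite_eval_eq _ _ <| Set.infinite_of_injective_forall_mem
    (f := fun n : ℕ => n * w) ((mul_left_injective₀ hw).comp Nat.cast_injective) fun n => ?_
  simpa using hq.nat_mul_eq n

theorem exists_eq_C_mul_X_add_C {B : R[X]}
    (h : ∀ z w, z * B.eval z - w * B.eval w = (z - w) * B.eval (z + w)) :
    ∃ a b, B = C a * X + C b := by
  have two_mul_B : C 2 * B = C (B.eval 1 - B.eval (-1)) * X + C (B.eval 1 + B.eval (-1)) :=
    Polynomial.funext fun z => by
      have h₁ := h z 1
      have h₂ := h (z + 1) (-1)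
      rw [add_neg_cancel_right] at h₂
      simp only [eval_mul, eval_add, eval_C, eval_X]
      linear_combination (z + 1) * h₁ + (z - 1) * h₂
  refine exists_eq_X_add_C_of_natDegree_le_one ?_
  rw [← natDegree_C_mul (two_ne_zero (α := R)), two_mul_B]
  exact natDegree_linear_le

end Bivariate

section Virasoro

variable {R : Type*} [CommRing R] {F : R[X][X]}

/-- The module identity for a Virasoro element `L` with `[L_λ L] = (∂ + 2λ) L` acting on a rank one
module by `L_λ v = F(∂, λ) v`. -/
def IsVirasoroCoeff (F : R[X][X]) : Prop :=
  ∀ x z w : R, F.evalEval (x + z) w * F.evalEval x z - F.evalEval (x + w) z * F.evalEval x w =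
    (z - w) * F.evalEval x (z + w)

variable [IsDomain R] [CharZero R]

theorem IsVirasoroCoeff.exists_evalEval_zero_right (h : IsVirasoroCoeff F) (hF : F ≠ 0) :
    ∃ b, ∀ x, F.evalEval x 0 = x + b := by
  obtain ⟨x, w, hxw⟩ := exists_evalEval_ne_zero hF
  have key : F.map (evalRingHom x) * (taylor x (F.eval 0) - C (F.evalEval x 0) - X) = 0 :=
    Polynomial.funext fun w => by
      have := h x 0 w
      simp only [eval_mul, map_evalRingHom_eval, eval_sub, taylor_eval, eval_C, eval_X, eval_zero,
        add_zero, zero_sub, zero_add, evalEval, C_0, add_comm w x] at this ⊢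
      linear_combination -this
  have hg : taylor x (F.eval 0) - C (F.evalEval x 0) - X = 0 :=
    (mul_eq_zero.1 key).resolve_left fun h0 => hxw <| by
      rw [← map_evalRingHom_eval, h0, eval_zero]
  refine ⟨F.evalEval x 0 - x, fun y => ?_⟩
  have := congrArg (eval (y - x)) hg
  simp only [eval_sub, taylor_eval, eval_C, eval_X, eval_zero, sub_add_cancel] at this
  rw [evalEval, C_0]
  linear_combination this

theorem IsVirasoroCoeff.evalEval_mul_evalEval_neg (h : IsVirasoroCoeff F) {b : R}
    (hb : ∀ x, F.evalEval x 0 = x + b) (x y w : R) :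
    F.evalEval x w * F.evalEval (x + w) (-w) - (x + b) * (x + b + w) =
      F.evalEval y w * F.evalEval (y + w) (-w) - (y + b) * (y + b + w) := by
  rcases eq_or_ne w 0 with rfl | hw
  · simp only [neg_zero, add_zero, hb]
    ring
  set q := F.eval (C w) * (F.eval (C (-w))).comp (X + C w) - (X + C b) * (X + C b + C w) with hq
  have eval_q (x : R) : q.eval x =
      F.evalEval x w * F.evalEval (x + w) (-w) - (x + b) * (x + b + w) := by simp [hq, evalEval]
  rw [← eval_q, ← eval_q]
  refine eval_eq_eval_of_periodic hw (fun x => ?_) x y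
  have := h (x + w) (-w) w
  simp only [neg_add_cancel, add_neg_cancel_right, hb] at this
  simp only [eval_q]
  linear_combination -this

theorem IsVirasoroCoeff.exists_evalEval_eq_add (h : IsVirasoroCoeff F) (hF : F ≠ 0) :
    ∃ B : R[X], ∀ x w, F.evalEval x w = x + B.eval w := by
  obtain ⟨b, hb⟩ := h.exists_evalEval_zero_right hF
  set G := Bivariate.swap F with hG
  have key : G * taylor X (G.map (compRingHom (-X))) = (X + C (C b)) * (X + C (X + C b)) +
      C (G.eval 0 * (taylor X (G.map (compRingHom (-X)))).eval 0 - C b * (C b + X)) := by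
    refine ext_evalEval fun w x => ?_
    have := h.evalEval_mul_evalEval_neg hb x 0 w
    have eval_zero_eq (H : R[X][X]) : (H.eval 0).eval w = H.evalEval w 0 := by simp [evalEval]
    simp only [evalEval_mul, evalEval_add, evalEval_X, evalEval_C, eval_sub, eval_mul, eval_add,
      eval_X, eval_C, evalEval_taylor_X, evalEval_map_compRingHom_neg_X, eval_zero_eq, hG,
      evalEval_swap]
    linear_combination this
  obtain ⟨natDegree_G, isUnit_G⟩ := natDegree_eq_one_of_mul_taylor_eq key
  rw [leadingCoeff, natDegree_G, isUnit_iff] at isUnit_G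
  obtain ⟨c, -, hc⟩ := isUnit_G
  have G_eq := eq_X_add_C_of_natDegree_le_one natDegree_G.le
  have evalEval_F (x w : R) : F.evalEval x w = c * x + (G.coeff 0).eval w := by
    rw [← evalEval_swap, ← hG, G_eq, ← hc]
    simp [evalEval]
  have c_eq_one : c = 1 := by linear_combination hb 1 - hb 0 - evalEval_F 1 0 + evalEval_F 0 0
  exact ⟨G.coeff 0, fun x w => by rw [evalEval_F, c_eq_one, one_mul]⟩

theorem IsVirasoroCoeff.exists_eq (h : IsVirasoroCoeff F) (hF : F ≠ 0) :
    ∃ a b, F = C X + C (C a) * X + C (C b) := by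
  obtain ⟨B, hB⟩ := h.exists_evalEval_eq_add hF
  obtain ⟨a, b, rfl⟩ := exists_eq_C_mul_X_add_C (B := B) fun z w => by
    have := h 0 z w
    simp only [hB] at this
    linear_combination this
  refine ⟨a, b, ext_evalEval fun x w => ?_⟩
  simp [evalEval, hB, add_assoc]

end Virasoro

section Intertwiner

variable {R : Type*} [CommRing R] {a b a' b' n : R} {F : R[X][X]}

/-- The module identity for a primary element `u` of conformal weight `n + 1` acting between rank
one modules by `u_λ v = F(∂, λ) v'`, where the Virasoro element acts by `L_λ v = (∂ + aλ + b) v`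
and `L_λ v' = (∂ + a'λ + b') v'`. -/
def IsIntertwiner (a b a' b' n : R) (F : R[X][X]) : Prop :=
  ∀ x z w : R, F.evalEval (x + z) w * (x + a' * z + b') -
    (x + w + a * z + b) * F.evalEval x w = (n * z - w) * F.evalEval x (z + w)

theorem IsIntertwiner.sub {G : R[X][X]} (hF : IsIntertwiner a b a' b' n F)
    (hG : IsIntertwiner a b a' b' n G) : IsIntertwiner a b a' b' n (F - G) := fun x z w => by
  simp only [evalEval_sub]
  linear_combination hF x z w - hG x z w

theorem isIntertwiner_C_C (a b c : R) : IsIntertwiner a b a b 0 (C (C c)) := fun x z w => by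
  simp only [evalEval_CC]
  ring

theorem IsIntertwiner.mul_evalEval (h : IsIntertwiner a b a b n F) (x z : R) :
    n * (z * F.evalEval x z) =
      (x + a * z + b) * (F.evalEval (x + z) 0 - F.evalEval x 0) := by
  have := h x z 0
  simp only [add_zero, sub_zero] at this
  linear_combination -this

variable [IsDomain R] [CharZero R]

theorem IsIntertwiner.eq_of_ne_zero (h : IsIntertwiner a b a' b' n F) (hF : F ≠ 0) : b' = b := by
  obtain ⟨x, w, hxw⟩ := exists_evalEval_ne_zero hF
  have := h x 0 w
  simp only [add_zero, zero_add, mul_zero] at this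
  exact mul_right_cancel₀ hxw (by linear_combination this)

theorem IsIntertwiner.eq_zero_of_evalEval_zero_right (h : IsIntertwiner a b a b n F)
    (h0 : ∀ x, F.evalEval x 0 = 0) : F = 0 := by
  refine eq_zero_of_evalEval fun x w => ?_
  rcases eq_or_ne w 0 with rfl | hw
  · exact h0 x
  set r := (X + C (w + (b - a * w))) * F.eval (C w) with hr
  have eval_r (y : R) : r.eval y = (y + (w + (b - a * w))) * F.evalEval y w := by
    simp [hr, evalEval]
  have periodic_r : Function.Periodic (fun y => r.eval y) w := fun y => by
    have := h (y + w) (-w) w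
    simp only [neg_add_cancel, add_neg_cancel_right, h0] at this
    simp only [eval_r]
    linear_combination -this
  have r_zero (y : R) : r.eval y = 0 := by
    rw [eval_eq_eval_of_periodic hw periodic_r y (-(w + (b - a * w))), eval_r, neg_add_cancel,
      zero_mul]
  rw [evalEval, ← eval_zero (x := x)]
  refine eval_eq_of_add_mul_eval_eq (w + (b - a * w)) (fun y => ?_) x
  rw [eval_zero, mul_zero, ← r_zero y, eval_r, evalEval]

theorem IsIntertwiner.exists_eq_C_C (h : IsIntertwiner a b a b 0 F) : ∃ c, F = C (C c) := by
  have const (x : R) : F.evalEval x 0 = F.evalEval 0 0 := by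
    have := eval_eq_of_add_mul_eval_eq (p := (F.eval 0).comp (X + C x)) (q := F.eval 0) (a * x + b)
      (fun y => by
        have := h.mul_evalEval y x
        simp only [eval_comp, eval_add, eval_X, eval_C, evalEval, C_0] at this ⊢
        linear_combination -this) 0
    simpa [evalEval] using this
  refine ⟨F.evalEval 0 0, sub_eq_zero.1 ?_⟩
  refine (h.sub (isIntertwiner_C_C a b _)).eq_zero_of_evalEval_zero_right fun x => ?_
  rw [evalEval_sub, evalEval_CC, const, sub_self]

theorem IsIntertwiner.eq_zero_of_commute (h : IsIntertwiner a b a b n F) (hn : n ≠ 0)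
    (hcomm : ∀ x z w, F.evalEval (x + z) w * F.evalEval x z =
      F.evalEval (x + w) z * F.evalEval x w) : F = 0 := by
  have key : C (C n) * (X * F ^ 2) = 0 := eq_zero_of_evalEval fun x w => by
    have h₁ := h.mul_evalEval x w
    have h₂ := hcomm x 0 w
    simp only [add_zero] at h₂
    simp only [evalEval_mul, evalEval_CC, evalEval_X, evalEval_pow]
    linear_combination F.evalEval x w * h₁ - (x + a * w + b) * h₂
  simpa [hn] using key

theorem IsIntertwiner.mul_evalEval_zero_right (hF : IsIntertwiner a b a b n F) (x : R) :
    n * F.evalEval x 0 = (x + b) * (F.eval 0).derivative.eval x := by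
  obtain ⟨g, hg, hg0⟩ := exists_eval_add_eq_add_mul (F.eval 0) x
  have key : X * (C n * F.map (evalRingHom x)) = X * ((C a * X + C (x + b)) * g) :=
    Polynomial.funext fun z => by
      have := hF.mul_evalEval x z
      simp only [evalEval, C_0, hg] at this
      simp only [eval_mul, eval_add, eval_X, eval_C, map_evalRingHom_eval, evalEval]
      linear_combination this
  simpa [map_evalRingHom_eval, hg0] using congrArg (eval 0) (mul_left_cancel₀ X_ne_zero key)

section BracketSelf

variable {H : R[X][X]} {κ : R}
  (h : ∀ x z w, F.evalEval (x + z) w * F.evalEval x z - F.evalEval (x + w) z * F.evalEval x w =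
    κ * (z - w) * H.evalEval x (z + w))
include h

theorem derivative_mul_evalEval_zero_right_of_bracket_self (x : R) :
    (F.eval 0).derivative.eval x * F.evalEval x 0 = κ * H.evalEval x 0 := by
  obtain ⟨g, hg, hg0⟩ := exists_eval_add_eq_add_mul (F.eval 0) x
  have key : X * (g * F.map (evalRingHom x)) = X * (C κ * H.map (evalRingHom x)) :=
    Polynomial.funext fun z => by
      have := h x z 0
      simp only [evalEval, C_0, add_zero, hg] at this
      simp only [eval_mul, eval_X, eval_C, map_evalRingHom_eval, evalEval]
      linear_combination this
  simpa [map_evalRingHom_eval, hg0] using congrArg (eval 0) (mul_left_cancel₀ X_ne_zero key)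

theorem IsIntertwiner.mul_sq_sub_eq_of_bracket_self (hF : IsIntertwiner a b a b n F)
    (hH : IsIntertwiner a b a b (2 * n - 1) H) (x z : R) :
    (2 * n - 1) * (F.evalEval (x + z) 0 - F.evalEval x 0) ^ 2 =
      κ * n * z * (H.evalEval (x + z) 0 - H.evalEval x 0) := by
  have := eval_eq_of_add_mul_eval_eq (a * z + b)
    (p := C (2 * n - 1) * ((F.eval 0).comp (X + C z) - F.eval 0) ^ 2)
    (q := C (κ * n * z) * ((H.eval 0).comp (X + C z) - H.eval 0)) (fun x => by
      have hx := h x z 0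
      have hFx := hF.mul_evalEval x z
      have hHx := hH.mul_evalEval x z
      simp only [evalEval, C_0, add_zero, sub_zero] at hx hFx hHx
      simp only [eval_mul, eval_C, eval_pow, eval_sub, eval_comp, eval_add, eval_X]
      linear_combination (2 * n - 1) * n * z * hx - (2 * n - 1) *
        ((F.eval 0).eval (x + z) - (F.eval 0).eval x) * hFx + κ * n * z * hHx) x
  simpa [evalEval] using this

-- Based at `-b`, where `f(x) = F(x, 0)` vanishes, the identities above read
-- `(2n - 1) f² = κn(x + b)h = n² f²`, with `h(x) = H(x, 0)`.
theorem IsIntertwiner.eq_zero_of_bracket_self (hF : IsIntertwiner a b a b n F)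
    (hH : IsIntertwiner a b a b (2 * n - 1) H) (hn0 : n ≠ 0) (hn1 : n ≠ 1) : F = 0 := by
  have F_neg_b : F.evalEval (-b) 0 = 0 := by
    simpa [hn0] using hF.mul_evalEval_zero_right (-b)
  have H_neg_b : κ * H.evalEval (-b) 0 = 0 := by
    rw [← derivative_mul_evalEval_zero_right_of_bracket_self h, F_neg_b, mul_zero]
  refine hF.eq_zero_of_evalEval_zero_right fun x => ?_
  have difference := hF.mul_sq_sub_eq_of_bracket_self h hH (-b) (x + b)
  have euler := hF.mul_evalEval_zero_right x
  have bracket := derivative_mul_evalEval_zero_right_of_bracket_self h x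
  rw [neg_add_cancel_comm_assoc, F_neg_b, sub_zero] at difference
  have : (n - 1) ^ 2 * F.evalEval x 0 ^ 2 = 0 := by
    linear_combination n * F.evalEval x 0 * euler + n * (x + b) * bracket - difference +
      n * (x + b) * H_neg_b
  simpa [sub_eq_zero, hn1] using this

end BracketSelf

theorem constant_or_linear_of_shift {f : R[X]} (hf : f ≠ 0) {b e u : R}
    (h : ∀ x z, f.eval (x + z) * (x + b + e * z) = f.eval x * (x + b + u * z)) :
    ∃ σ ≠ 0, (e = u ∧ f = C σ) ∨ (e = 0 ∧ u = 1 ∧ f = C σ * (X + C b)) := by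
  have e_mul (y : R) : e * f.eval y = u * f.eval (-b) := by
    have := eval_eq_of_add_mul_eval_eq b (p := C e * f) (q := C (u * f.eval (-b)))
      (fun y => by
        have := h (-b) (y + b)
        rw [neg_add_cancel_comm_assoc] at this
        simp only [eval_mul, eval_C]
        linear_combination this) y
    simpa using this
  rcases eq_or_ne e 0 with rfl | he
  · have f_eval (y : R) : f.eval y = f.eval (1 - b) * (1 - u + u * (y + b)) := by
      have := h (1 - b) (y - (1 - b))
      rw [add_sub_cancel] at this
      linear_combination this
    have hσ : f.eval (1 - b) ≠ 0 := fun h0 => hf <| Polynomial.funext fun y => by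
      rw [f_eval, h0, zero_mul, eval_zero]
    refine ⟨f.eval (1 - b), hσ, ?_⟩
    have hu : u * (1 - u) = 0 := mul_left_cancel₀ hσ <| by
      linear_combination -e_mul 0 - u * f_eval (-b)
    rcases mul_eq_zero.1 hu with rfl | hu
    · exact .inl ⟨rfl, Polynomial.funext fun y => by simpa using f_eval y⟩
    · obtain rfl : u = 1 := by linear_combination -hu
      exact .inr ⟨rfl, rfl, Polynomial.funext fun y => by simpa using f_eval y⟩
  · have f_eq : f = C (f.eval (-b)) := Polynomial.funext fun y => mul_left_cancel₀ he <| by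
      rw [eval_C, e_mul, e_mul]
    have hσ : f.eval (-b) ≠ 0 := fun h0 => hf <| by rw [f_eq, h0, C_0]
    exact ⟨_, hσ, .inl ⟨mul_right_cancel₀ hσ (e_mul _), f_eq⟩⟩

theorem IsIntertwiner.constant_or_linear {d : R} (h : IsIntertwiner a b a' b 1 F) (hF : F ≠ 0)
    (hd : ∀ x z w, (d + 1) * F.evalEval (x + z) w - d * F.evalEval x w = F.evalEval x (z + w)) :
    ∃ σ ≠ 0, (a' = a + 1 ∧ F = C (C σ)) ∨
      (a' = a ∧ d + 1 = a ∧ F = C (C σ) * (C X + C (C a) * X + C (C b))) := by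
  have F_eq (x z : R) :
      F.evalEval x z = (d + 1) * (F.eval 0).eval (x + z) - d * (F.eval 0).eval x := by
    simpa [evalEval] using (hd x z 0).symm
  have hf : F.eval 0 ≠ 0 := fun h0 => hF <| eq_zero_of_evalEval fun x z => by simp [F_eq, h0]
  obtain ⟨σ, hσ, ⟨he, hf⟩ | ⟨he, hu, hf⟩⟩ := constant_or_linear_of_shift hf (b := b)
    (e := a' - (d + 1)) (u := a - d) fun x z => by
      have := h x z 0
      simp only [add_zero, sub_zero, one_mul] at this
      rw [F_eq x z] at this
      simp only [evalEval, C_0] at this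
      linear_combination this
  · refine ⟨σ, hσ, .inl ⟨by linear_combination he, ext_evalEval fun x z => ?_⟩⟩
    simp only [F_eq, hf, eval_C, evalEval_CC]
    ring
  · refine ⟨σ, hσ, .inr ⟨by linear_combination he - hu, by linear_combination -hu,
      ext_evalEval fun x z => ?_⟩⟩
    obtain rfl : d = a - 1 := by linear_combination -hu
    simp only [F_eq, hf, evalEval_mul, evalEval_add, evalEval_C, evalEval_X, eval_mul, eval_add,
      eval_X, eval_C]
    ring

end Intertwiner

section PairIdentity

theorem evalEval_cst (c x w : ℂ) : (cst c).evalEval x w = c := evalEval_CC x w c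

theorem evalEval_del (x w : ℂ) : del.evalEval x w = x := by
  rw [del, evalEval_C, eval_X]

theorem cst_zero : cst 0 = 0 := by
  rw [cst, C_0, C_0]

/-- The conformal weight of a generator with respect to `p⁻¹ L_0`, minus one: this is the parameter
`n` of `IsIntertwiner`. -/
noncomputable def Gen.weight (p : ℂ) : Gen → ℂ
  | (.L, j) => 1 + j / p
  | (.W, j) => j / p
  | (.G, j) => 1 + j / p

theorem pairTarget_even {k : Kind} (hk : k.parity = 0) (j : ℕ) (i : ZMod 2) :
    pairTarget (k, j) i = i := by
  rw [pairTarget, hk, zero_add]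

theorem pairTarget_G (j : ℕ) (i : ZMod 2) : pairTarget (.G, j) i = i + 1 := add_comm _ _

theorem pairTarget_target (x x' : Gen) (i : ZMod 2) :
    pairTarget (x.target x') i = pairTarget x (pairTarget x' i) := by
  simp only [pairTarget, Gen.target, Kind.parity_target, add_assoc]

theorem pairTarget_comm (x x' : Gen) (i : ZMod 2) :
    pairTarget x (pairTarget x' i) = pairTarget x' (pairTarget x i) :=
  add_left_comm _ _ _

theorem evalEval_bracketCoeff_L_zero {p : ℂ} (hp : p ≠ 0) (x : Gen) (z w : ℂ) :
    (bracketCoeff p (.L, 0) x).evalEval (-(z + w)) z = p * (x.weight p * z - w) := by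
  obtain ⟨_ | _ | _, j⟩ := x <;> simp [bracketCoeff, evalEval_C, Gen.weight] <;> field_simp <;> ring

theorem target_L_zero (x : Gen) : Gen.target (.L, 0) x = x :=
  Prod.ext rfl (zero_add _)

namespace PairIdentity

variable {p : ℂ} {P : Gen → ZMod 2 → ℂ[X][X]}

theorem shift (h : PairIdentity p P) : PairIdentity p fun x i => P x (i + 1) := fun x x' i z w => by
  simpa only [pairTarget, add_assoc] using h x x' (i + 1) z w

theorem evalEval_eq (h : PairIdentity p P) (x x' : Gen) (i : ZMod 2) (t z w : ℂ) :
    (P x' i).evalEval (t + z) w * (P x (pairTarget x' i)).evalEval t z -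
        paritySign x.1.parity x'.1.parity *
          ((P x i).evalEval (t + w) z * (P x' (pairTarget x i)).evalEval t w) =
      (bracketCoeff p x x').evalEval (-(z + w)) z * (P (x.target x') i).evalEval t (z + w) := by
  simpa [evalEval] using congrArg (eval t) (h x x' i z w)

theorem evalEval_eq_of_even (h : PairIdentity p P) {k : Kind} (hk : k.parity = 0) (j : ℕ) (x : Gen)
    (i : ZMod 2) (t z w : ℂ) :
    (P x i).evalEval (t + z) w * (P (k, j) (pairTarget x i)).evalEval t z -
        (P (k, j) i).evalEval (t + w) z * (P x i).evalEval t w =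
      (bracketCoeff p (k, j) x).evalEval (-(z + w)) z *
        (P (Gen.target (k, j) x) i).evalEval t (z + w) := by
  have := h.evalEval_eq (k, j) x i t z w
  rwa [pairTarget_even hk, paritySign, if_neg (by simp [hk]), one_mul] at this

theorem evalEval_L_zero_eq (h : PairIdentity p P) (hp : p ≠ 0) (x : Gen) (i : ZMod 2)
    (t z w : ℂ) :
    (P x i).evalEval (t + z) w * (P (.L, 0) (pairTarget x i)).evalEval t z -
        (P (.L, 0) i).evalEval (t + w) z * (P x i).evalEval t w =
      p * (x.weight p * z - w) * (P x i).evalEval t (z + w) := by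
  rw [h.evalEval_eq_of_even rfl, evalEval_bracketCoeff_L_zero hp, target_L_zero]

theorem eq_zero_of_L_zero (h : PairIdentity p P) (hp : p ≠ 0) {i : ZMod 2}
    (h0 : P (.L, 0) i = 0) (x : Gen) : P x i = 0 := by
  have key : P x i * (cst p * lam + C ((P (.L, 0) (pairTarget x i)).eval 0)) = 0 :=
    eq_zero_of_evalEval fun t w => by
      have := h.evalEval_L_zero_eq hp x i t 0 w
      simp only [h0, evalEval_zero, add_zero, zero_add] at this
      simp only [evalEval_mul, evalEval_add, evalEval_X, evalEval_C, eval_C]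
      rw [← C_0, ← evalEval]
      linear_combination this
  refine (mul_eq_zero.1 key).resolve_right fun h1 => hp ?_
  simpa using congrArg (fun F => (F.coeff 1).coeff 0) h1

theorem L_zero_eq (h : PairIdentity p P) (hp : p ≠ 0) {i : ZMod 2} (hne : P (.L, 0) i ≠ 0) :
    ∃ a b, P (.L, 0) i = cst p * (del + cst a * lam + cst b) := by
  have cst_mul_cst_inv : cst p * cst p⁻¹ = 1 := by
    rw [← C_mul, ← C_mul, mul_inv_cancel₀ hp, C_1, C_1]
  have virasoro : IsVirasoroCoeff (cst p⁻¹ * P (.L, 0) i) := fun t z w => by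
    have := h.evalEval_L_zero_eq hp (.L, 0) i t z w
    rw [pairTarget_even rfl, Gen.weight] at this
    simp only [evalEval_mul, evalEval_cst]
    apply mul_left_cancel₀ (pow_ne_zero 2 hp)
    field_simp
    linear_combination this
  obtain ⟨a, b, hab⟩ := virasoro.exists_eq fun h0 => hne <| by
    rw [← one_mul (P _ i), ← cst_mul_cst_inv, mul_assoc, h0, mul_zero]
  exact ⟨a, b, by rw [← hab, ← mul_assoc, cst_mul_cst_inv, one_mul]⟩

variable {i : ZMod 2} {a b a' b' : ℂ}

theorem isIntertwiner (h : PairIdentity p P) (hp : p ≠ 0) (x : Gen)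
    (hi : P (.L, 0) i = cst p * (del + cst a * lam + cst b))
    (hi' : P (.L, 0) (pairTarget x i) = cst p * (del + cst a' * lam + cst b')) :
    IsIntertwiner a b a' b' (x.weight p) (P x i) := fun t z w => by
  have := h.evalEval_L_zero_eq hp x i t z w
  simp only [hi, hi', evalEval_mul, evalEval_add, evalEval_cst, evalEval_del, evalEval_X] at this
  apply mul_left_cancel₀ hp
  linear_combination this

theorem isIntertwiner_of_even (h : PairIdentity p P) (hp : p ≠ 0) {k : Kind} (hk : k.parity = 0)
    (j : ℕ) (hi : P (.L, 0) i = cst p * (del + cst a * lam + cst b)) :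
    IsIntertwiner a b a b (Gen.weight p (k, j)) (P (k, j) i) :=
  h.isIntertwiner hp (k, j) hi (by rw [pairTarget_even hk, hi])

theorem W_zero_eq (h : PairIdentity p P) (hp : p ≠ 0)
    (hi : P (.L, 0) i = cst p * (del + cst a * lam + cst b)) : ∃ d, P (.W, 0) i = cst d := by
  have := h.isIntertwiner_of_even hp (k := .W) rfl 0 hi
  rw [Gen.weight, Nat.cast_zero, zero_div] at this
  exact this.exists_eq_C_C

theorem W_succ_eq_zero (h : PairIdentity p P) (hp : p ≠ 0)
    (hi : P (.L, 0) i = cst p * (del + cst a * lam + cst b)) (j : ℕ) : P (.W, j + 1) i = 0 := by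
  refine (h.isIntertwiner_of_even hp (k := .W) rfl (j + 1) hi).eq_zero_of_commute
    (div_ne_zero (Nat.cast_ne_zero.2 j.succ_ne_zero) hp) fun t z w => ?_
  have := h.evalEval_eq_of_even (k := .W) rfl (j + 1) (.W, j + 1) i t z w
  rw [pairTarget_even rfl, bracketCoeff, evalEval_zero, zero_mul] at this
  linear_combination this

theorem L_eq_of_ne_zero (h : PairIdentity p P) (hp : p ≠ 0)
    (hi : P (.L, 0) i = cst p * (del + cst a * lam + cst b)) {j : ℕ} (hj : j ≠ 0)
    (hne : P (.L, j) i ≠ 0) : p = -j ∧ ∃ c, P (.L, j) i = cst c := by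
  have hF := h.isIntertwiner_of_even hp (k := .L) rfl j hi
  have hH := h.isIntertwiner_of_even hp (k := .L) rfl (j + j) hi
  rw [Gen.weight] at hF
  rw [Gen.weight, show (1 : ℂ) + (j + j : ℕ) / p = 2 * (1 + j / p) - 1 by push_cast; ring] at hH
  have bracket (x z w : ℂ) := h.evalEval_eq_of_even (k := .L) rfl j (.L, j) i x z w
  have weight_ne_one : 1 + (j : ℂ) / p ≠ 1 := by simp [hj, hp]
  have weight_eq_zero : 1 + (j : ℂ) / p = 0 := by
    by_contra weight_ne_zero
    refine hne (hF.eq_zero_of_bracket_self (κ := j + p) (fun x z w => ?_) hH weight_ne_zero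
      weight_ne_one)
    have := bracket x z w
    simp only [pairTarget_even (k := .L) rfl, bracketCoeff, evalEval_add, evalEval_mul,
      evalEval_cst, evalEval_del, evalEval_X, Gen.target, Kind.target] at this
    linear_combination this
  refine ⟨?_, (weight_eq_zero ▸ hF).exists_eq_C_C⟩
  field_simp at weight_eq_zero
  linear_combination weight_eq_zero

theorem L_add_two_eq_zero (h : PairIdentity p P) (hp : p ≠ 0)
    (hi : P (.L, 0) i = cst p * (del + cst a * lam + cst b)) (j : ℕ) : P (.L, j + 2) i = 0 := by
  by_contra hne
  obtain ⟨hpj, -⟩ := h.L_eq_of_ne_zero hp hi (Nat.succ_ne_zero _) hne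
  have L_eq_zero {l : ℕ} (hl : l ≠ 0) (hlj : l < j + 2) : P (.L, l) i = 0 := by
    by_contra hc
    have := neg_injective (hpj.symm.trans (h.L_eq_of_ne_zero hp hi hl hc).1)
    exact hlj.ne' (Nat.cast_injective this)
  have key : cst (1 + p) * lam * P (.L, j + 2) i = 0 := eq_zero_of_evalEval fun t w => by
    have := h.evalEval_eq_of_even (k := .L) rfl 1 (.L, j + 1) i t 0 w
    rw [L_eq_zero one_ne_zero (by omega), L_eq_zero j.succ_ne_zero (by omega)] at this
    simp only [Gen.target, Kind.target, bracketCoeff, show 1 + (j + 1) = j + 2 by omega,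
      evalEval_zero, evalEval_add, evalEval_mul, evalEval_cst, evalEval_del, evalEval_X] at this ⊢
    rw [zero_add] at this
    push_cast at this
    linear_combination this
  have : 1 + p = 0 := by
    simpa only [mul_eq_zero, hne, X_ne_zero, C_eq_zero, or_false] using key
  rw [hpj] at this
  push_cast at this
  exact Nat.cast_add_one_ne_zero (R := ℂ) j (by linear_combination -this)

theorem L_one_eq (h : PairIdentity p P) (hp : p ≠ 0)
    (hi : P (.L, 0) i = cst p * (del + cst a * lam + cst b)) :
    ∃ c, (p ≠ -1 → c = 0) ∧ P (.L, 1) i = cst c := by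
  by_cases h0 : P (.L, 1) i = 0
  · exact ⟨0, fun _ => rfl, by rw [cst_zero, h0]⟩
  · obtain ⟨h1, c, hc⟩ := h.L_eq_of_ne_zero hp hi one_ne_zero h0
    exact ⟨c, fun h2 => absurd (by simpa using h1) h2, hc⟩

theorem G_succ_eq_zero (h : PairIdentity p P) {j : ℕ} (hi : P (.W, j + 1) i = 0)
    (hi' : P (.W, j + 1) (i + 1) = 0) : P (.G, j + 1) i = 0 :=
  eq_zero_of_evalEval fun t w => by
    have := h.evalEval_eq_of_even (k := .W) rfl (j + 1) (.G, 0) i t 0 w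
    simpa [pairTarget_G, hi, hi', Gen.target, Kind.target, bracketCoeff] using this.symm

theorem evalEval_G_zero_of_W_zero (h : PairIdentity p P) {d d' : ℂ} (hd : P (.W, 0) i = cst d)
    (hd' : P (.W, 0) (i + 1) = cst d') (t z w : ℂ) :
    d' * (P (.G, 0) i).evalEval (t + z) w - d * (P (.G, 0) i).evalEval t w =
      (P (.G, 0) i).evalEval t (z + w) := by
  have := h.evalEval_eq_of_even (k := .W) rfl 0 (.G, 0) i t z w
  rw [pairTarget_G, hd, hd', evalEval_cst, evalEval_cst, bracketCoeff, evalEval_one,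
    one_mul] at this
  exact (by ring : _ = _).trans this

theorem W_zero_add_one (h : PairIdentity p P) {d d' : ℂ} (hd : P (.W, 0) i = cst d)
    (hd' : P (.W, 0) (i + 1) = cst d') (hne : P (.G, 0) i ≠ 0) : d' = d + 1 := by
  obtain ⟨t, w, htw⟩ := exists_evalEval_ne_zero hne
  have := h.evalEval_G_zero_of_W_zero hd hd' t 0 w
  rw [zero_add, add_zero] at this
  exact mul_right_cancel₀ htw (by linear_combination this)

theorem evalEval_G_zero_of_L_one (h : PairIdentity p P) {c c' : ℂ} (hc : P (.L, 1) i = cst c)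
    (hc' : P (.L, 1) (i + 1) = cst c') (hG : P (.G, 1) i = 0) (t z w : ℂ) :
    c' * (P (.G, 0) i).evalEval (t + z) w = c * (P (.G, 0) i).evalEval t w := by
  have := h.evalEval_eq_of_even (k := .L) rfl 1 (.G, 0) i t z w
  rw [pairTarget_G, hc, hc', evalEval_cst, evalEval_cst, show Gen.target (.L, 1) (.G, 0) = (.G, 1)
    from rfl, hG, evalEval_zero, mul_zero] at this
  linear_combination this

theorem G_zero_eq (h : PairIdentity p P) (hp : p ≠ 0) {d d' c c' : ℂ}
    (hi : P (.L, 0) i = cst p * (del + cst a * lam + cst b))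
    (hi' : P (.L, 0) (i + 1) = cst p * (del + cst a' * lam + cst b'))
    (hc : P (.L, 1) i = cst c) (hc' : P (.L, 1) (i + 1) = cst c')
    (hd : P (.W, 0) i = cst d) (hd' : P (.W, 0) (i + 1) = cst d')
    (hG : P (.G, 1) i = 0) (hne : P (.G, 0) i ≠ 0) :
    b' = b ∧ ∃ σ ≠ 0, (a' = a + 1 ∧ c' = c ∧ P (.G, 0) i = cst σ) ∨
      (a' = a ∧ c' = 0 ∧ c = 0 ∧ d' = a ∧
        P (.G, 0) i = cst σ * (del + cst a * lam + cst b)) := by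
  have intertwiner := h.isIntertwiner hp (.G, 0) hi (by rw [pairTarget_G, hi'])
  rw [Gen.weight, Nat.cast_zero, zero_div, add_zero] at intertwiner
  obtain rfl := intertwiner.eq_of_ne_zero hne
  obtain rfl := h.W_zero_add_one hd hd' hne
  have L_one := h.evalEval_G_zero_of_L_one hc hc' hG
  obtain ⟨σ, hσ, ⟨ha, hσG⟩ | ⟨ha, hda, hσG⟩⟩ :=
    intertwiner.constant_or_linear hne (h.evalEval_G_zero_of_W_zero hd hd')
  · have := L_one 0 0 0
    rw [hσG, evalEval_cst, evalEval_cst] at this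
    exact ⟨rfl, σ, hσ, .inl ⟨ha, mul_right_cancel₀ hσ this, hσG⟩⟩
  · simp only [hσG, evalEval_mul, evalEval_add, evalEval_cst, evalEval_del, evalEval_X] at L_one
    obtain rfl : c' = 0 := mul_left_cancel₀ hσ (by linear_combination L_one (-b') 1 0)
    obtain rfl : c = 0 := mul_left_cancel₀ hσ (by linear_combination -L_one (1 - b') 0 0)
    exact ⟨rfl, σ, hσ, .inr ⟨ha, rfl, rfl, hda, hσG⟩⟩

end PairIdentity

/-- Among the generators, only `L_0`, `L_1`, `W_0` and `G_0` may act non-trivially on `v_i`. -/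
def IsReducedAt (P : Gen → ZMod 2 → ℂ[X][X]) (i : ZMod 2) : Prop :=
  ∀ j, P (.L, j + 2) i = 0 ∧ P (.W, j + 1) i = 0 ∧ P (.G, j + 1) i = 0

theorem IsReducedAt.ext {P Q : Gen → ZMod 2 → ℂ[X][X]} {i : ZMod 2} (hP : IsReducedAt P i)
    (hQ : IsReducedAt Q i) (hL₀ : P (.L, 0) i = Q (.L, 0) i) (hL₁ : P (.L, 1) i = Q (.L, 1) i)
    (hW : P (.W, 0) i = Q (.W, 0) i) (hG : P (.G, 0) i = Q (.G, 0) i) (x : Gen) :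
    P x i = Q x i :=
  match x with
  | (.L, 0) => hL₀
  | (.L, 1) => hL₁
  | (.L, j + 2) => (hP j).1.trans (hQ j).1.symm
  | (.W, 0) => hW
  | (.W, j + 1) => (hP j).2.1.trans (hQ j).2.1.symm
  | (.G, 0) => hG
  | (.G, j + 1) => (hP j).2.2.trans (hQ j).2.2.symm

namespace PairIdentity

variable {p : ℂ} {P : Gen → ZMod 2 → ℂ[X][X]}

theorem isReducedAt (h : PairIdentity p P) (hp : p ≠ 0) (hL : ∀ i, P (.L, 0) i ≠ 0)
    (i : ZMod 2) : IsReducedAt P i := fun j => by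
  have W_succ_eq_zero (i : ZMod 2) : P (.W, j + 1) i = 0 := by
    obtain ⟨a, b, hi⟩ := h.L_zero_eq hp (hL i)
    exact h.W_succ_eq_zero hp hi j
  obtain ⟨a, b, hi⟩ := h.L_zero_eq hp (hL i)
  exact ⟨h.L_add_two_eq_zero hp hi j, W_succ_eq_zero i,
    h.G_succ_eq_zero (W_succ_eq_zero i) (W_succ_eq_zero (i + 1))⟩

theorem exists_eq_sumCoeff (h : PairIdentity p P) (hp : p ≠ 0) (hL : ∀ i, P (.L, 0) i ≠ 0)
    (hG : ∀ i, P (.G, 0) i = 0) :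
    ∃ a b c d a' b' c' d' : ℂ, (p ≠ -1 → c = 0 ∧ c' = 0) ∧
      P = sumCoeff p a b c d a' b' c' d' := by
  choose a b ha using fun i => h.L_zero_eq hp (hL i)
  choose c hc hc' using fun i => h.L_one_eq hp (ha i)
  choose d hd using fun i => h.W_zero_eq hp (ha i)
  refine ⟨a 0, b 0, c 0, d 0, a 1, b 1, c 1, d 1, fun hp1 => ⟨hc 0 hp1, hc 1 hp1⟩, ?_⟩
  funext x i
  refine (h.isReducedAt hp hL i).ext (fun _ => ⟨rfl, rfl, rfl⟩) ?_ ?_ ?_ ?_ x <;>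
    obtain rfl | rfl : i = 0 ∨ i = 1 := by decide +revert
  all_goals simp [sumCoeff, ha, hc', hd, hG]

theorem exists_eq_constCoeff_or_linCoeff (h : PairIdentity p P) (hp : p ≠ 0)
    (hL : ∀ i, P (.L, 0) i ≠ 0) (hG : P (.G, 0) 0 ≠ 0) :
    (∃ a b c d σ : ℂ, (p ≠ -1 → c = 0) ∧ σ ≠ 0 ∧ P = constCoeff p a b c d σ) ∨
      ∃ a b σ : ℂ, σ ≠ 0 ∧ P = linCoeff p a b σ := by
  have reduced := h.isReducedAt hp hL
  obtain ⟨a, b, ha⟩ := h.L_zero_eq hp (hL 0)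
  obtain ⟨a', b', ha'⟩ := h.L_zero_eq hp (hL 1)
  obtain ⟨c, hc, hc₀⟩ := h.L_one_eq hp ha
  obtain ⟨c', -, hc₁⟩ := h.L_one_eq hp ha'
  obtain ⟨d, hd⟩ := h.W_zero_eq hp ha
  obtain ⟨d', hd'⟩ := h.W_zero_eq hp ha'
  obtain rfl : d' = d + 1 := h.W_zero_add_one hd hd' hG
  have hG' : P (.G, 0) 1 = 0 := by
    by_contra hG'
    have : d = d + 1 + 1 := h.W_zero_add_one (i := 1) hd' hd hG'
    exact two_ne_zero (α := ℂ) (by linear_combination -this)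
  obtain ⟨rfl, σ, hσ, ⟨rfl, rfl, hσG⟩ | ⟨rfl, rfl, rfl, hda, hσG⟩⟩ :=
    h.G_zero_eq (i := 0) hp ha ha' hc₀ hc₁ hd hd' (reduced 0 0).2.2 hG
  · refine .inl ⟨a, b', c', d, σ, hc, hσ, funext₂ fun x i => ?_⟩
    refine (reduced i).ext (fun _ => ⟨rfl, rfl, rfl⟩) ?_ ?_ ?_ ?_ x <;>
      obtain rfl | rfl : i = 0 ∨ i = 1 := by decide +revert
    all_goals simp [constCoeff, ha, ha', hc₀, hc₁, hd, hd', hσG, hG']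
  · obtain rfl : d = a' - 1 := eq_sub_of_add_eq hda
    refine .inr ⟨a', b', σ, hσ, funext₂ fun x i => ?_⟩
    refine (reduced i).ext (fun _ => ⟨rfl, rfl, rfl⟩) ?_ ?_ ?_ ?_ x <;>
      obtain rfl | rfl : i = 0 ∨ i = 1 := by decide +revert
    all_goals simp [linCoeff, ha, ha', hc₀, hc₁, hd, hd', hσG, hG']

end PairIdentity

end PairIdentity

section Substitution

/-- The polynomial `∑ ℓ(q_k) λ ^ k` obtained from `q = ∑ λ ^ k q_k` in `M[λ]` by applying the linear
form `ℓ` to the coefficients. -/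
noncomputable def lamCoord {R M : Type*} [CommSemiring R] [AddCommMonoid M] [Module R M]
    (ℓ : M →ₗ[R] R) (q : ℕ →₀ M) : R[X] :=
  q.sum fun k m => monomial k (ℓ m)

theorem coeff_lamCoord {R M : Type*} [CommSemiring R] [AddCommMonoid M] [Module R M]
    (ℓ : M →ₗ[R] R) (q : ℕ →₀ M) (k : ℕ) : (lamCoord ℓ q).coeff k = ℓ (q k) := by
  simp only [lamCoord, Finsupp.sum, finsetSum_coeff, coeff_monomial]
  rw [Finset.sum_ite_eq' q.support k fun k => ℓ (q k), ite_eq_left_iff]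
  intro hk
  rw [Finsupp.notMem_support_iff.1 hk, map_zero]

theorem eval_lamCoord {R M : Type*} [CommSemiring R] [AddCommMonoid M] [Module R M]
    (ℓ : M →ₗ[R] R) (q : ℕ →₀ M) (r : R) :
    (lamCoord ℓ q).eval r = ℓ (q.sum fun k m => r ^ k • m) := by
  simp only [lamCoord, Finsupp.sum, eval_finsetSum, eval_monomial, map_sum, map_smul, smul_eq_mul,
    mul_comm]

variable {M : Type*} [AddCommGroup M] [Module ℂ M] [Module ℂ[X] M] [IsScalarTower ℂ ℂ[X] M]

theorem C_smul (c : ℂ) (m : M) : (C c : ℂ[X]) • m = c • m :=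
  algebraMap_smul ℂ[X] c m

theorem subst_eq_sum (r : ℂ[X]) (q : ℕ →₀ M) : subst r q = q.sum fun k m => r ^ k • m := rfl

theorem subst_C (z : ℂ) (q : ℕ →₀ M) : subst (C z) q = q.sum fun k m => z ^ k • m := by
  simp only [subst_eq_sum, ← C_pow, C_smul]

theorem subst_mem {U : Submodule ℂ[X] M} {q : ℕ →₀ M} (hq : ∀ k, q k ∈ U) (r : ℂ[X]) :
    subst r q ∈ U :=
  U.sum_mem fun k _ => U.smul_mem _ (hq k)

theorem eq_of_subst_eq {q q' : ℕ →₀ M} (h : ∀ z : ℂ, subst (C z) q = subst (C z) q') : q = q' := by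
  refine Finsupp.ext fun k => sub_eq_zero.1 <|
    (Module.forall_dual_apply_eq_zero_iff ℂ _).1 fun φ => ?_
  have lamCoord_eq : lamCoord φ q = lamCoord φ q' := Polynomial.funext fun z => by
    rw [eval_lamCoord, eval_lamCoord, ← subst_C, ← subst_C, h]
  rw [map_sub, ← coeff_lamCoord, ← coeff_lamCoord, lamCoord_eq, sub_self]

theorem subst_mapRange {N : Type*} [AddCommGroup N] [Module ℂ N] [Module ℂ[X] N]
    [IsScalarTower ℂ ℂ[X] N] (e : M →ₗ[ℂ[X]] N) (q : ℕ →₀ M) (r : ℂ[X]) :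
    subst r (q.mapRange e (map_zero e)) = e (subst r q) := by
  rw [subst_eq_sum, subst_eq_sum, Finsupp.sum_mapRange_index fun _ => smul_zero _, map_finsuppSum]
  simp only [map_smul]

end Substitution

namespace ConformalModule

variable {S : Type*} [AddCommGroup S] [Module ℂ S] [Module ℂ[X] S] [IsScalarTower ℂ ℂ[X] S]
  {A : LieConformalSuperalgebra S}
  {M : Type*} [AddCommGroup M] [Module ℂ M] [Module ℂ[X] M] [IsScalarTower ℂ ℂ[X] M]
  {N : Type*} [AddCommGroup N] [Module ℂ N] [Module ℂ[X] N] [IsScalarTower ℂ ℂ[X] N]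
  {K : Type*} [AddCommGroup K] [Module ℂ K] [Module ℂ[X] K] [IsScalarTower ℂ ℂ[X] K]
  {V : ConformalModule A M} {W : ConformalModule A N} {U : ConformalModule A K}

theorem Isomorphic.trans (h : V.Isomorphic W) (h' : W.Isomorphic U) : V.Isomorphic U := by
  obtain ⟨e, he, hact⟩ := h
  obtain ⟨e', he', hact'⟩ := h'
  exact ⟨e.trans e', fun i v hv => he' i _ (he i v hv), fun a v k => by
    rw [LinearEquiv.trans_apply, LinearEquiv.trans_apply, hact', hact]⟩

theorem subst_act_smul_left (V : ConformalModule A M) (f : ℂ[X]) (a : S) (v : M) (z : ℂ) :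
    subst (C z) (V.act (f • a) v) = f.comp (-C z) • subst (C z) (V.act a v) := by
  induction f using Polynomial.induction_on generalizing a with
  | C c => rw [C_smul, map_smul, LinearMap.smul_apply, map_smul, C_comp, C_smul]
  | add f g hf hg => simp only [add_smul, map_add, LinearMap.add_apply, hf, hg, add_comp]
  | monomial n c ih =>
    rw [pow_succ, ← mul_assoc, mul_smul, ih, V.act_del_left, mul_comp _ X, X_comp, mul_smul,
      neg_smul, C_smul]

theorem subst_act_smul_right (V : ConformalModule A M) (g : ℂ[X]) (a : S) (v : M) (z : ℂ) :
    subst (C z) (V.act a (g • v)) = g.comp (X + C z) • subst (C z) (V.act a v) := by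
  induction g using Polynomial.induction_on generalizing v with
  | C c => rw [C_smul, map_smul, map_smul, C_comp, C_smul]
  | add f g hf hg => simp only [add_smul, map_add, hf, hg, add_comp]
  | monomial n c ih =>
    rw [pow_succ, ← mul_assoc, mul_smul, ih, V.act_del_right, mul_comp _ X, X_comp, mul_smul]

theorem act_eq_zero_of_span {s : Set S} {t : Set M} {v : M} (hs : Submodule.span ℂ[X] s = ⊤)
    (hv : v ∈ Submodule.span ℂ[X] t) (h : ∀ a ∈ s, ∀ v ∈ t, V.act a v = 0) (a : S) :
    V.act a v = 0 := by
  refine eq_of_subst_eq fun z => ?_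
  rw [map_zero]
  induction hs ▸ Submodule.mem_top (x := a) using Submodule.span_induction with
  | zero => rw [map_zero, LinearMap.zero_apply, map_zero]
  | add a a' _ _ ha ha' => rw [map_add, LinearMap.add_apply, map_add, ha, ha', add_zero]
  | smul f a _ ha => rw [subst_act_smul_left, ha, smul_zero]
  | mem a ha =>
    induction hv using Submodule.span_induction with
    | zero => rw [map_zero, map_zero]
    | add v v' _ _ hv hv' => rw [map_add, map_add, hv, hv', add_zero]
    | smul g v _ hv => rw [subst_act_smul_right, hv, smul_zero]
    | mem v hv => rw [h a ha v hv, map_zero]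

theorem isomorphic_of_span {s : Set S} {t : Set M} (hs : Submodule.span ℂ[X] s = ⊤)
    (ht : Submodule.span ℂ[X] t = ⊤) (e : M ≃ₗ[ℂ[X]] N) (he : ∀ i, ∀ v ∈ V.part i, e v ∈ W.part i)
    (h : ∀ a ∈ s, ∀ v ∈ t, ∀ z : ℂ, subst (C z) (W.act a (e v)) = e (subst (C z) (V.act a v))) :
    V.Isomorphic W := by
  have subst_act (a : S) (v : M) (z : ℂ) :
      subst (C z) (W.act a (e v)) = e (subst (C z) (V.act a v)) := by
    induction hs ▸ Submodule.mem_top (x := a) using Submodule.span_induction with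
    | zero => simp only [map_zero, LinearMap.zero_apply]
    | add a a' _ _ ha ha' => simp only [map_add, LinearMap.add_apply, ha, ha']
    | smul f a _ ha => rw [subst_act_smul_left, subst_act_smul_left, ha, map_smul]
    | mem a ha =>
      induction ht ▸ Submodule.mem_top (x := v) using Submodule.span_induction with
      | zero => simp only [map_zero]
      | add v v' _ _ hv hv' => simp only [map_add, hv, hv']
      | smul g v _ hv => rw [subst_act_smul_right, map_smul, subst_act_smul_right, hv, map_smul]
      | mem v hv => exact h a ha v hv z
  refine ⟨e, he, fun a v k => ?_⟩
  have act_eq : W.act a (e v) = (V.act a v).mapRange e (map_zero e) := eq_of_subst_eq fun z =>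
    (subst_act a v z).trans (subst_mapRange e.toLinearMap _ _).symm
  rw [act_eq, Finsupp.mapRange_apply]

/-- A basis of a conformal module of rank `1 + 1` consisting of one element of each parity, the
element of parity `i` being indexed by `i`. -/
def IsHomogeneousBasis (V : ConformalModule A M) (b : Module.Basis (ZMod 2) ℂ[X] M) : Prop :=
  ∀ i, V.part i = Submodule.span ℂ[X] {b i}

theorem IsHomogeneousBasis.mem_part {b : Module.Basis (ZMod 2) ℂ[X] M}
    (hb : V.IsHomogeneousBasis b) (i : ZMod 2) : b i ∈ V.part i :=
  hb i ▸ Submodule.mem_span_singleton_self _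

theorem IsHomogeneousBasis.coord_smul {b : Module.Basis (ZMod 2) ℂ[X] M}
    (hb : V.IsHomogeneousBasis b) {i : ZMod 2} {v : M} (hv : v ∈ V.part i) :
    b.coord i v • b i = v := by
  rw [hb, Submodule.mem_span_singleton] at hv
  obtain ⟨c, rfl⟩ := hv
  rw [map_smul, Module.Basis.coord_apply, Module.Basis.repr_self, Finsupp.single_eq_same,
    smul_eq_mul, mul_one]

theorem IsHomogeneousBasis.isomorphic {b : Module.Basis (ZMod 2) ℂ[X] M}
    (hb : V.IsHomogeneousBasis b) {s : Set S} (hs : Submodule.span ℂ[X] s = ⊤)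
    (e : M ≃ₗ[ℂ[X]] N) (he : ∀ i, e (b i) ∈ W.part i)
    (h : ∀ a ∈ s, ∀ i, ∀ z : ℂ,
      subst (C z) (W.act a (e (b i))) = e (subst (C z) (V.act a (b i)))) :
    V.Isomorphic W := by
  refine isomorphic_of_span hs b.span_eq e (fun i v hv => ?_) fun a ha _ hv z => ?_
  · rw [← hb.coord_smul hv, map_smul]
    exact Submodule.smul_mem _ _ (he i)
  · obtain ⟨i, rfl⟩ := hv
    exact h a ha i z

theorem IsHomogeneousBasis.exists_act_ne_zero {b : Module.Basis (ZMod 2) ℂ[X] M}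
    (hb : V.IsHomogeneousBasis b) {s : Set S} (hs : Submodule.span ℂ[X] s = ⊤) {i : ZMod 2}
    (hV : V.ActsNontriviallyOn i) : ∃ a ∈ s, V.act a (b i) ≠ 0 := by
  obtain ⟨a, v, hv, hav⟩ := hV
  contrapose! hav
  exact act_eq_zero_of_span hs (hb i ▸ hv) (fun a ha v hv =>
    (Set.mem_singleton_iff.1 hv).symm ▸ hav a ha) a

theorem IsFreeOfRank.finite {m n : ℕ} (h : V.IsFreeOfRank m n) : Module.Finite ℂ[X] M := by
  obtain ⟨hfree, h0, h1⟩ := h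
  rw [← Module.rank_lt_aleph0_iff, ← Submodule.rank_quotient_add_rank (V.part 0),
    (Submodule.quotientEquivOfIsCompl _ _ V.isCompl).rank_eq, h0, h1]
  exact Cardinal.add_lt_aleph0 Cardinal.natCast_lt_aleph0 Cardinal.natCast_lt_aleph0

theorem IsFreeOfRank.exists_isHomogeneousBasis (h : V.IsFreeOfRank 1 1) :
    ∃ b, V.IsHomogeneousBasis b := by
  have := h.finite
  obtain ⟨hfree, h0, h1⟩ := h
  have exists_generator (i : ZMod 2) : ∃ v : M, v ≠ 0 ∧ V.part i = Submodule.span ℂ[X] {v} := by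
    have finrank_eq_one : Module.finrank ℂ[X] (V.part i) = 1 := by
      obtain rfl | rfl : i = 0 ∨ i = 1 := by decide +revert
      exacts [Module.finrank_eq_of_rank_eq h0, Module.finrank_eq_of_rank_eq h1]
    obtain ⟨v, hv, hspan⟩ := finrank_eq_one_iff'.1 finrank_eq_one
    refine ⟨v, fun h0 => hv (Subtype.ext h0), le_antisymm (fun w hw => ?_) <|
      (Submodule.span_singleton_le_iff_mem _ _).2 v.2⟩
    obtain ⟨c, hc⟩ := hspan ⟨w, hw⟩
    exact Submodule.mem_span_singleton.2 ⟨c, congrArg Subtype.val hc⟩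
  choose v v_ne_zero part_eq using exists_generator
  have v_mem (i : ZMod 2) : v i ∈ V.part i := part_eq i ▸ Submodule.mem_span_singleton_self _
  have linearIndependent_v : LinearIndependent ℂ[X] v :=
    ((iSupIndep_pair zero_ne_one (by decide)).2 V.isCompl.disjoint).linearIndependent _ v_mem
      v_ne_zero
  have part_le (i : ZMod 2) : V.part i ≤ Submodule.span ℂ[X] (Set.range v) := by
    rw [part_eq]
    exact Submodule.span_mono (Set.singleton_subset_iff.2 ⟨i, rfl⟩)
  refine ⟨.mk linearIndependent_v ?_, fun i => by rw [Module.Basis.mk_apply, part_eq]⟩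
  rw [← V.isCompl.sup_eq_top]
  exact sup_le (part_le 0) (part_le 1)

end ConformalModule

section SuperBlock

variable {p : ℂ}

theorem span_range_generator :
    Submodule.span ℂ[X] (Set.range fun x : Gen => Finsupp.single x (1 : ℂ[X])) = ⊤ := by
  rw [← Finsupp.coe_basisSingleOne, Module.Basis.span_eq]

theorem single_one_mem_part (x : Gen) : Finsupp.single x 1 ∈ (superBlock p).part x.1.parity :=
  single_mem_freePart (fun x : Gen => x.1.parity) x 1

theorem subst_bracket_single_one (x x' : Gen) (r : ℂ[X]) :
    subst r ((superBlock p).bracket (Finsupp.single x 1) (Finsupp.single x' 1)) =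
      (bracketCoeff p x x').eval r • Finsupp.single (x.target x') 1 := by
  rw [superBlock, subst_freeAct, one_comp, one_comp, one_mul, one_mul, Finsupp.smul_single,
    smul_eq_mul, mul_one]

namespace ConformalModule

variable {M : Type*} [AddCommGroup M] [Module ℂ M] [Module ℂ[X] M] [IsScalarTower ℂ ℂ[X] M]
  {V : ConformalModule (superBlock p) M} {b : Module.Basis (ZMod 2) ℂ[X] M}

/-- The coefficients `P x i ∈ ℂ[∂, λ]` of the action `x_λ b_i = P x i (∂, λ) b_{i + |x|}` of the
generators on a homogeneous basis `b`. -/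
noncomputable def structureCoeff (V : ConformalModule (superBlock p) M)
    (b : Module.Basis (ZMod 2) ℂ[X] M) (x : Gen) (i : ZMod 2) : ℂ[X][X] :=
  lamCoord (b.coord (pairTarget x i)) (V.act (Finsupp.single x 1) (b i))

theorem IsHomogeneousBasis.subst_act_single_one (hb : V.IsHomogeneousBasis b) (x : Gen)
    (i : ZMod 2) (r : ℂ[X]) :
    subst r (V.act (Finsupp.single x 1) (b i)) =
      (V.structureCoeff b x i).eval r • b (pairTarget x i) := by
  have act_mem := V.act_mem x.1.parity i (Finsupp.single x 1) (single_one_mem_part x) (b i)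
    (hb.mem_part i)
  have subst_act_mem : subst r (V.act (Finsupp.single x 1) (b i)) ∈ V.part (pairTarget x i) :=
    subst_mem act_mem r
  rw [structureCoeff, eval_lamCoord, ← subst_eq_sum, hb.coord_smul subst_act_mem]

theorem IsHomogeneousBasis.pairIdentity (hb : V.IsHomogeneousBasis b) :
    PairIdentity p (V.structureCoeff b) := fun x x' i z w => by
  have jacobi := V.jacobi x.1.parity x'.1.parity _ (single_one_mem_part x) _
    (single_one_mem_part x') (b i) z w
  simp only [subst_bracket_single_one, subst_act_smul_left, subst_act_smul_right,
    hb.subst_act_single_one, pairTarget_target, pairTarget_comm x' x, smul_smul, ← C_smul,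
    ← sub_smul] at jacobi
  have := congrArg (b.coord (pairTarget x (pairTarget x' i))) jacobi
  simp only [map_smul, Module.Basis.coord_apply, Module.Basis.repr_self, Finsupp.single_eq_same,
    smul_eq_mul, mul_one] at this
  rwa [smul_eq_C_mul]

theorem IsHomogeneousBasis.isomorphic_pairModule (hb : V.IsHomogeneousBasis b) :
    V.Isomorphic (pairModule p (V.structureCoeff b) hb.pairIdentity) := by
  refine hb.isomorphic span_range_generator b.repr (fun i => ?_) ?_
  · rw [Module.Basis.repr_self]
    exact single_mem_freePart id i 1
  · rintro _ ⟨x, rfl⟩ i z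
    rw [hb.subst_act_single_one, map_smul, Module.Basis.repr_self, Module.Basis.repr_self,
      pairModule, subst_freeAct, one_comp, one_comp, one_mul, one_mul, Finsupp.smul_single,
      smul_eq_mul, mul_one]

theorem IsHomogeneousBasis.structureCoeff_L_zero_ne_zero (hb : V.IsHomogeneousBasis b) (hp : p ≠ 0)
    {i : ZMod 2} (hV : V.ActsNontriviallyOn i) : V.structureCoeff b (.L, 0) i ≠ 0 := fun h0 => by
  obtain ⟨_, ⟨x, rfl⟩, hx⟩ := hb.exists_act_ne_zero span_range_generator hV
  refine hx (eq_of_subst_eq fun z => ?_)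
  rw [hb.subst_act_single_one, hb.pairIdentity.eq_zero_of_L_zero hp h0, eval_zero, zero_smul,
    map_zero]

theorem IsFreeOfRank.exists_isomorphic_pairModule (hV : V.IsFreeOfRank 1 1) (hp : p ≠ 0)
    (hV' : ∀ i, V.ActsNontriviallyOn i) :
    ∃ (P : Gen → ZMod 2 → ℂ[X][X]) (hP : PairIdentity p P), (∀ i, P (.L, 0) i ≠ 0) ∧
      V.Isomorphic (pairModule p P hP) := by
  obtain ⟨b, hb⟩ := hV.exists_isHomogeneousBasis
  exact ⟨V.structureCoeff b, hb.pairIdentity,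
    fun i => hb.structureCoeff_L_zero_ne_zero hp (hV' i), hb.isomorphic_pairModule⟩

end ConformalModule

theorem isHomogeneousBasis_pairModule {P : Gen → ZMod 2 → ℂ[X][X]} (h : PairIdentity p P) :
    (pairModule p P h).IsHomogeneousBasis Finsupp.basisSingleOne := fun i => by
  change Finsupp.supported ℂ[X] ℂ[X] {j | j = i} = _
  rw [Set.ofPred_eq_eq_singleton, Finsupp.supported_eq_span_single, Set.image_singleton,
    Finsupp.coe_basisSingleOne]

theorem pairModule_isomorphic_parityChange {P Q : Gen → ZMod 2 → ℂ[X][X]} (hP : PairIdentity p P)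
    (hQ : PairIdentity p Q) (h : (fun x i => P x (i + 1)) = Q) :
    (pairModule p P hP).Isomorphic (pairModule p Q hQ).parityChange := by
  subst h
  refine (isHomogeneousBasis_pairModule hP).isomorphic span_range_generator
    (Finsupp.domLCongr (Equiv.addRight 1)) (fun i => ?_) ?_
  · rw [Finsupp.coe_basisSingleOne, Finsupp.domLCongr_single]
    exact single_mem_freePart id (i + 1) 1
  · rintro _ ⟨x, rfl⟩ i z
    rw [Finsupp.coe_basisSingleOne, Finsupp.domLCongr_single, ConformalModule.parityChange,
      pairModule, pairModule, subst_freeAct, subst_freeAct, Finsupp.domLCongr_single,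
      Equiv.coe_addRight, add_assoc i, CharTwo.add_self_eq_zero, add_zero]
    exact congrArg (Finsupp.single · _) (add_assoc _ _ _).symm

end SuperBlock

end LieConformal

theorem mainTheorem3 (p : ℂ) (hp : p ≠ 0)
    {M : Type*} [AddCommGroup M] [Module ℂ M] [Module ℂ[X] M] [IsScalarTower ℂ ℂ[X] M]
    (V : LieConformal.ConformalModule (LieConformal.superBlock p) M)
    (hfree : V.IsFreeOfRank 1 1)
    (hnontriv : ∀ i : ZMod 2, V.ActsNontriviallyOn i) :
    (∃ (a b c d a' b' c' d' : ℂ) (h : p ≠ -1 → c = 0 ∧ c' = 0),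
      V.Isomorphic (LieConformal.sumModule p a b c d a' b' c' d' h)) ∨
    (∃ (a b c d σ : ℂ) (h : p ≠ -1 → c = 0), σ ≠ 0 ∧
      V.Isomorphic (LieConformal.constModule p a b c d σ h)) ∨
    (∃ a b σ : ℂ, σ ≠ 0 ∧
      V.Isomorphic (LieConformal.linModule p a b σ)) ∨
    (∃ (a b c d σ : ℂ) (h : p ≠ -1 → c = 0), σ ≠ 0 ∧
      V.Isomorphic (LieConformal.constModule p (a - 1) b c (d - 1) σ h).parityChange) ∨
    (∃ a b σ : ℂ, σ ≠ 0 ∧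
      V.Isomorphic (LieConformal.linModule p a b σ).parityChange) := by
  obtain ⟨P, hP, hL, hV⟩ := hfree.exists_isomorphic_pairModule hp hnontriv
  by_cases hG₀ : P (.G, 0) 0 = 0
  · by_cases hG₁ : P (.G, 0) 1 = 0
    · obtain ⟨a, b, c, d, a', b', c', d', hc, rfl⟩ :=
        hP.exists_eq_sumCoeff hp hL (Fin.forall_fin_two.2 ⟨hG₀, hG₁⟩)
      exact .inl ⟨a, b, c, d, a', b', c', d', hc, hV⟩
    · obtain ⟨a, b, c, d, σ, hc, hσ, hQ⟩ | ⟨a, b, σ, hσ, hQ⟩ :=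
        hP.shift.exists_eq_constCoeff_or_linCoeff hp (fun i => hL (i + 1)) hG₁
      · refine .inr <| .inr <| .inr <| .inl ⟨a + 1, b, c, d + 1, σ, hc, hσ, ?_⟩
        simp only [add_sub_cancel_right]
        exact hV.trans (LieConformal.pairModule_isomorphic_parityChange hP _ hQ)
      · exact .inr <| .inr <| .inr <| .inr
          ⟨a, b, σ, hσ, hV.trans (LieConformal.pairModule_isomorphic_parityChange hP _ hQ)⟩
  · obtain ⟨a, b, c, d, σ, hc, hσ, rfl⟩ | ⟨a, b, σ, hσ, rfl⟩ :=
      hP.exists_eq_constCoeff_or_linCoeff hp hL hG₀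
    · exact .inr <| .inl ⟨a, b, c, d, σ, hc, hσ, hV⟩
    · exact .inr <| .inr <| .inl ⟨a, b, σ, hσ, hV⟩
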